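/- An instance of unweighted complete correlation clustering on $n\ge 1$ vertices is a complete graph on a vertex set $V$, $|V|=n$, each of whose edges is labeled positive or negative. A clustering $\mathcal C$ is a partition of $V$; a disagreement is a positive edge between two clusters or a negative edge inside a cluster; $y_{\mathcal C}(u)$ is the number of disagreements incident to $u$; and $\mathrm{OPT}(p)=\min_{\mathcal C}\|y_{\mathcal C}\|_p$. Let $N_u^+$ be the set of positive neighbors of $u$ together with $u$ itself, $N_u^-=V\setminus N_u^+$, and $d_{uv}=1-|N_u^+\cap N_v^+|/|N_u^+\cup N_v^+|$. Let $R$ be the set of vertices $u$ with $|\{v\in N_u^-: d_{uv}\le 0.7\}|\ge\frac{10}{3}|N_u^+|$. The adjusted correlation metric is $f_{uu}=0$ and, for $u\ne v$, $f_{uv}=1$ if $u\in R$ or $v\in R$ or if $(u,v)$ is negative with $d_{uv}>0.7$, and $f_{uv}=d_{uv}$ otherwise. The KMZ rounding algorithm, with input $z$ and $r=1/5$, starts with $S=V$ and, while $S\neq\emptyset$, chooses $w\in S$ maximizing $\sum_{v\in S,\,z_{wv}\le r}(r-z_{wv})$, makes $\{v\in S: z_{wv}\le 2r\}$ a cluster,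 and removes it from $S$. Theorem. Let $T(n)$ be such that two $n\times n$ matrices over $\mathbb Q$ can be multiplied in time $O(T(n))$ (for instance $T(n)=n^\omega$), where time is the number of steps of a random access machine with unit-cost exact rational arithmetic. Then there is an algorithm on the same machine that, given any instance of unweighted complete correlation clustering on $n\ge1$ vertices as a matrix of edge labels, runs in time $O(T(n))$ and returns a single clustering $\mathcal C$. This clustering is one that the KMZ rounding algorithm returns on the adjusted correlation metric $f$, and simultaneously for all $p\in[1,\infty]$, $$\|y_{\mathcal C}\|_p\le 6348\cdot \mathrm{OPT}(p).$$ -/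

import Mathlib

/-! ## Correlation clustering

An instance of unweighted complete correlation clustering on the vertex set `V` is given by the
graph `G` of its positive edges; a pair of distinct vertices that are not adjacent in `G` is a
negative edge.  A clustering (a partition of `V`) is a `Setoid V`, whose classes are the clusters.
-/

namespace CorrelationClustering

section Problem

variable {V : Type*} [Fintype V]

open Classical in
/-- `disagreements G C u` is the number of edges incident to `u` that are disagreements with respect
to the clustering `C`: positive edges whose endpoints lie in different clusters and negative edges
whose endpoints lie in the same cluster. -/
noncomputable def disagreements (G : SimpleGraph V) (C : Setoid V) (u : V) : ℕ :=
  (Finset.univ.filter fun v => u ≠ v ∧ ((G.Adj u v ∧ ¬ C u v) ∨ (¬ G.Adj u v ∧ C u v))).card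

/-- The `ℓ_p`-norm of the disagreement vector of the clustering `C`. -/
noncomputable def cost (G : SimpleGraph V) (p : ENNReal) (C : Setoid V) : ℝ :=
  ‖WithLp.toLp p (fun u => (disagreements G C u : ℝ))‖

/-- The optimal objective value for the `ℓ_p`-norm; the infimum is over the finitely many clusterings
of `V`, so it is attained. -/
noncomputable def opt (G : SimpleGraph V) (p : ENNReal) : ℝ :=
  ⨅ C : Setoid V, cost G p C

end Problem

/-! ## The adjusted correlation metric -/

section Metric

variable {V : Type*} [Fintype V]

open Classical in
/-- The positive neighborhood of `u`, with the positive self-loop at `u`. -/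
noncomputable def posNbhd (G : SimpleGraph V) (u : V) : Finset V :=
  Finset.univ.filter fun v => v = u ∨ G.Adj u v

open Classical in
/-- The negative neighborhood of `u`. -/
noncomputable def negNbhd (G : SimpleGraph V) (u : V) : Finset V :=
  Finset.univ.filter fun v => v ≠ u ∧ ¬ G.Adj u v

open Classical in
/-- The correlation metric. -/
noncomputable def corrMetric (G : SimpleGraph V) (u v : V) : ℚ :=
  1 - ((posNbhd G u ∩ posNbhd G v).card : ℚ) / ((posNbhd G u ∪ posNbhd G v).card : ℚ)

open Classical in
/-- The vertices `u` with at least `10/3` times as many negative neighbors at correlation distance at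
most `0.7` as positive neighbors: all their distances to other vertices get rounded up to `1`. -/
def IsIsolated (G : SimpleGraph V) (u : V) : Prop :=
  (10 / 3 : ℚ) * ((posNbhd G u).card : ℚ) ≤
    (((negNbhd G u).filter fun v => corrMetric G u v ≤ 7 / 10).card : ℚ)

open Classical in
/-- The adjusted correlation metric. -/
noncomputable def adjCorrMetric (G : SimpleGraph V) (u v : V) : ℚ :=
  if u = v then 0
  else if IsIsolated G u ∨ IsIsolated G v then 1
  else if ¬ G.Adj u v ∧ 7 / 10 < corrMetric G u v then 1
  else corrMetric G u v

end Metric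

/-! ## The rounding algorithm of Kalhan, Makarychev and Zhou -/

section Rounding

variable {V : Type*} [Fintype V]

/-- The part of the ball of radius `ρ` around `u` that lies in `S`. -/
def ballIn (z : V → V → ℚ) (S : Finset V) (u : V) (ρ : ℚ) : Finset V :=
  S.filter fun v => z u v ≤ ρ

/-- The quantity maximized by the cluster centers, when `S` is the set of unclustered vertices. -/
def centrality (z : V → V → ℚ) (r : ℚ) (S : Finset V) (u : V) : ℚ :=
  ∑ v ∈ ballIn z S u r, (r - z u v)

open Classical in
/-- `RoundingRun z r S Cs`: when `S` is the set of unclustered vertices, the rounding algorithm with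
input `z` and parameter `r` can produce the clusters `Cs`, in this order, until no vertex is left.
Ties in the choice of the center may be broken in any way. -/
inductive RoundingRun (z : V → V → ℚ) (r : ℚ) : Finset V → List (Finset V) → Prop
  | done : RoundingRun z r ∅ []
  | step (S : Finset V) (u : V) (Cs : List (Finset V)) (hu : u ∈ S)
      (hmax : ∀ v ∈ S, centrality z r S v ≤ centrality z r S u)
      (hrest : RoundingRun z r (S \ ballIn z S u (2 * r)) Cs) :
      RoundingRun z r S (ballIn z S u (2 * r) :: Cs)

/-- `C` is a clustering returned by the rounding algorithm with input `z` and `r = 1/5`. -/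
def IsRoundingOutput (z : V → V → ℚ) (C : Setoid V) : Prop :=
  ∃ Cs : List (Finset V), RoundingRun z (1 / 5) Finset.univ Cs ∧
    ∀ u v : V, C u v ↔ ∃ A ∈ Cs, u ∈ A ∧ v ∈ A

end Rounding

end CorrelationClustering

/-! ## Machine model

A random access machine with unit-cost exact rational arithmetic and comparisons (no rounding and no
integer division), programmed in a structured language with finitely many registers and arrays. -/

namespace RatRAM

/-- The contents of the registers and of the arrays. -/
structure State where
  reg : ℕ → ℚ
  arr : ℕ → ℕ → ℚ

/-- Write the value `q` to the register `x`. -/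
def State.setReg (s : State) (x : ℕ) (q : ℚ) : State :=
  { s with reg := Function.update s.reg x q }

/-- Write the value `q` to cell `k` of the array `a`. -/
def State.setCell (s : State) (a k : ℕ) (q : ℚ) : State :=
  { s with arr := Function.update s.arr a (Function.update (s.arr a) k q) }

/-- Binary operations. -/
inductive Op
  | add | sub | mul | div | lt | eq

/-- The value of a binary operation: comparisons return `1` or `0`, division by `0` fails. -/
def Op.apply : Op → ℚ → ℚ → Option ℚ
  | .add, x, y => some (x + y)
  | .sub, x, y => some (x - y)
  | .mul, x, y => some (x * y)
  | .div, x, y => if y = 0 then none else some (x / y)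
  | .lt, x, y => some (if x < y then 1 else 0)
  | .eq, x, y => some (if x = y then 1 else 0)

/-- The array index denoted by a rational number; it fails unless this is a natural number. -/
def index (q : ℚ) : Option ℕ :=
  if q.den = 1 ∧ 0 ≤ q.num then some q.num.toNat else none

/-- Expressions: constants, registers, array cells and binary operations. -/
inductive Expr
  | const (q : ℚ)
  | reg (x : ℕ)
  | cell (a : ℕ) (i : Expr)
  | op (o : Op) (e₁ e₂ : Expr)

/-- The value of an expression, or `none` if the evaluation fails. -/
def Expr.eval (s : State) : Expr → Option ℚ
  | .const q => some q
  | .reg x => some (s.reg x)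
  | .cell a i => (i.eval s).bind fun q => (index q).map fun k => s.arr a k
  | .op o e₁ e₂ => (e₁.eval s).bind fun x => (e₂.eval s).bind fun y => o.apply x y

/-- The number of steps taken to evaluate an expression: one for every read and every operation. -/
def Expr.steps : Expr → ℕ
  | .const _ => 1
  | .reg _ => 1
  | .cell _ i => i.steps + 1
  | .op _ e₁ e₂ => e₁.steps + e₂.steps + 1

/-- Programs. -/
inductive Prog
  | skip
  | assign (x : ℕ) (e : Expr)
  | store (a : ℕ) (i e : Expr)
  | seq (P Q : Prog)
  | ite (e : Expr) (P Q : Prog)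
  | while (e : Expr) (P : Prog)

/-- `Runs P s t s'`: started in the state `s`, the program `P` halts after `t` steps in the state
`s'`, and no evaluation fails on the way. A condition holds if its value is not `0`. -/
inductive Runs : Prog → State → ℕ → State → Prop
  | skip (s : State) : Runs .skip s 1 s
  | assign (x : ℕ) (e : Expr) (s : State) (q : ℚ) (he : e.eval s = some q) :
      Runs (.assign x e) s (e.steps + 1) (s.setReg x q)
  | store (a : ℕ) (i e : Expr) (s : State) (j q : ℚ) (k : ℕ) (hi : i.eval s = some j)
      (hk : index j = some k) (he : e.eval s = some q) :
      Runs (.store a i e) s (i.steps + e.steps + 1) (s.setCell a k q)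
  | seq (P Q : Prog) (s s₁ s₂ : State) (t₁ t₂ : ℕ) (hP : Runs P s t₁ s₁) (hQ : Runs Q s₁ t₂ s₂) :
      Runs (.seq P Q) s (t₁ + t₂) s₂
  | iteTrue (e : Expr) (P Q : Prog) (s s' : State) (q : ℚ) (t : ℕ) (he : e.eval s = some q)
      (hq : q ≠ 0) (hP : Runs P s t s') : Runs (.ite e P Q) s (e.steps + 1 + t) s'
  | iteFalse (e : Expr) (P Q : Prog) (s s' : State) (t : ℕ) (he : e.eval s = some 0)
      (hQ : Runs Q s t s') : Runs (.ite e P Q) s (e.steps + 1 + t) s'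
  | whileTrue (e : Expr) (P : Prog) (s s₁ s₂ : State) (q : ℚ) (t₁ t₂ : ℕ) (he : e.eval s = some q)
      (hq : q ≠ 0) (hP : Runs P s t₁ s₁) (hrest : Runs (.while e P) s₁ t₂ s₂) :
      Runs (.while e P) s (e.steps + 1 + t₁ + t₂) s₂
  | whileFalse (e : Expr) (P : Prog) (s : State) (he : e.eval s = some 0) :
      Runs (.while e P) s (e.steps + 1) s

/-- An `n × n` matrix, stored row by row in an array whose remaining cells are `0`. -/
def matrixArray {n : ℕ} (A : Matrix (Fin n) (Fin n) ℚ) (k : ℕ) : ℚ :=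
  if h : k < n * n then
    A (finProdFinEquiv.symm ⟨k, h⟩).1 (finProdFinEquiv.symm ⟨k, h⟩).2
  else 0

/-- The initial state with two input matrices: the dimension is in register `0`, the matrices are in
the arrays `0` and `1`, and everything else is `0`. -/
def input {n : ℕ} (A B : Matrix (Fin n) (Fin n) ℚ) : State where
  reg x := if x = 0 then (n : ℚ) else 0
  arr a := if a = 0 then matrixArray A else if a = 1 then matrixArray B else fun _ => 0

/-- Multiplication of `n × n` matrices over `ℚ` takes time `O(T n)`: there is a program that, given
any two matrices, halts after `O(T n)` steps with their product in the array `2`. -/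
def MatrixMultiplicationTime (T : ℕ → ℝ) : Prop :=
  ∃ (P : Prog) (K : ℝ), ∀ n : ℕ, 0 < n → ∀ A B : Matrix (Fin n) (Fin n) ℚ,
    ∃ (t : ℕ) (s : State), Runs P (input A B) t s ∧ (t : ℝ) ≤ K * T n ∧
      ∀ i j : Fin n, s.arr 2 ((i : ℕ) * n + j) = (A * B) i j

open Classical in
/-- The initial state with an instance of correlation clustering on `Fin n`: `n` is in register `0`,
the `0`-`1` adjacency matrix of the positive edges is in the array `0`, everything else is `0`. -/
noncomputable def clusteringInput {n : ℕ} (G : SimpleGraph (Fin n)) : State :=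
  input (G.adjMatrix ℚ) 0

/-- The clustering of `Fin n` that a final state describes: cell `u` of the array `1` holds the label
of the cluster of `u`. -/
def clusteringOutput (n : ℕ) (s : State) : Setoid (Fin n) :=
  Setoid.ker fun u : Fin n => s.arr 1 u

end RatRAM

/-! Approximation. Read the adjusted metric f as a fractional solution in which a positive pair pays
f and a negative pair pays 1 - f, and let F = `fracCost` be the vector of costs per vertex. Two
facts suffice: ‖F‖_p ≤ 60 ‖y‖_p for the disagreement vector y of any clustering and any p
(`vecNorm_fracCost_le`), and y ≤ 52 F at every vertex for an output of the rounding
(`disagreements_le_of_isRoundingOutput`). As f and the second bound do not depend on p, one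
clustering serves all norms; 52 · 60 = 3120 is below 6348.

For the first fact, fix a clustering C with disagreement vector D. If C joins u and v, every element
of the symmetric difference of their positive neighborhoods is a disagreement at u or v; if C
separates them, so is every common positive neighbor. Hence a pair cost is at most D u + D v over
the size of a neighborhood, and F is bounded by nonnegative kernels applied to D. Their row and
column sums are bounded, so the Schur test `vecNorm_kernel_le` works for all p at once. The removal
of isolated vertices is what bounds the kernel of negative pairs; the positive edges at an isolated
u, which now cost 1, are paid for because its many close negative neighbors force disagreements at u
or at members of its cluster (`card_posNbhd_le_isoCharge`).

For the second fact, the Jaccard distance satisfies the triangle inequality, and f agrees with it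
wherever that is needed. Disagreements are paid for edge by edge or, in the critical range of
distances, by comparing the centrality of u with that of the chosen center. Negative pairs rounded
up to distance 1 inside a cluster pay nothing; they are counted separately by
`card_le_mul_fracCost`.

Running time. The common neighbor counts are the square of the adjacency matrix with self-loops.
Given them, each distance takes constantly many steps, and subtracting the contribution of each
removed vertex keeps all centralities current in O(n²) steps overall. This is absorbed by the
multiplication time, since writing a product already takes n² steps (`sq_le_of_runs`). The
multiplication program is a black box, run beside private data by `Runs.transfer`. -/

namespace CorrelationClustering

/-! ### Norms of vectors and the Schur test -/

section Norm

variable {V : Type*} [Fintype V]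

/-- The `ℓ_p`-norm of a real vector. -/
noncomputable def vecNorm (p : ENNReal) (g : V → ℝ) : ℝ := ‖WithLp.toLp p g‖

lemma vecNorm_top (g : V → ℝ) : vecNorm ⊤ g = ⨆ i, |g i| := by
  simp only [vecNorm, PiLp.norm_eq_ciSup, Real.norm_eq_abs]

lemma vecNorm_of_ne_top {p : ENNReal} (hp : 1 ≤ p) (hp' : p ≠ ⊤) (g : V → ℝ) :
    vecNorm p g = (∑ i, |g i| ^ p.toReal) ^ (1 / p.toReal) := by
  have h0 : 0 < p.toReal :=
    ENNReal.toReal_pos (fun h => by simp [h] at hp) hp'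
  simp only [vecNorm, PiLp.norm_eq_sum h0, Real.norm_eq_abs]

lemma one_le_toReal {p : ENNReal} (hp : 1 ≤ p) (hp' : p ≠ ⊤) : 1 ≤ p.toReal := by
  have := ENNReal.toReal_mono hp' hp
  simpa using this

lemma abs_le_ciSup_abs (g : V → ℝ) (v : V) : |g v| ≤ ⨆ i, |g i| :=
  le_ciSup (f := fun i => |g i|) (Set.finite_range _).bddAbove v

lemma vecNorm_mono {p : ENNReal} (hp : 1 ≤ p) {f g : V → ℝ} (hf : ∀ i, 0 ≤ f i)
    (hfg : ∀ i, f i ≤ g i) : vecNorm p f ≤ vecNorm p g := by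
  have habs : ∀ i, |f i| ≤ |g i| := fun i => by
    rw [abs_of_nonneg (hf i), abs_of_nonneg ((hf i).trans (hfg i))]; exact hfg i
  by_cases hp' : p = ⊤
  · subst hp'
    rw [vecNorm_top, vecNorm_top]
    exact ciSup_mono (Set.finite_range _).bddAbove habs
  · have h1 := one_le_toReal hp hp'
    rw [vecNorm_of_ne_top hp hp', vecNorm_of_ne_top hp hp']
    refine Real.rpow_le_rpow (by positivity) (Finset.sum_le_sum fun i _ => ?_) (by positivity)
    exact Real.rpow_le_rpow (abs_nonneg _) (habs i) (by positivity)

lemma vecNorm_add_le {p : ENNReal} (hp : 1 ≤ p) (f g : V → ℝ) :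
    vecNorm p (fun i => f i + g i) ≤ vecNorm p f + vecNorm p g := by
  have : Fact (1 ≤ p) := ⟨hp⟩
  exact norm_add_le (WithLp.toLp p f) (WithLp.toLp p g)

lemma vecNorm_smul {p : ENNReal} (hp : 1 ≤ p) {c : ℝ} (hc : 0 ≤ c) (g : V → ℝ) :
    vecNorm p (fun i => c * g i) = c * vecNorm p g := by
  have : Fact (1 ≤ p) := ⟨hp⟩
  have := norm_smul c (WithLp.toLp p g)
  rw [Real.norm_of_nonneg hc] at this
  exact this

/-- The Schur test for a matrix with nonnegative entries. -/
lemma vecNorm_kernel_le {p : ENNReal} (hp : 1 ≤ p) {K : V → V → ℝ} {c : ℝ} (hc : 0 ≤ c)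
    (hK : ∀ u v, 0 ≤ K u v) (hrow : ∀ u, ∑ v, K u v ≤ c) (hcol : ∀ v, ∑ u, K u v ≤ c)
    {g : V → ℝ} (hg : ∀ v, 0 ≤ g v) :
    vecNorm p (fun u => ∑ v, K u v * g v) ≤ c * vecNorm p g := by
  have hpos : ∀ u, 0 ≤ ∑ v, K u v * g v := fun u =>
    Finset.sum_nonneg fun v _ => mul_nonneg (hK u v) (hg v)
  by_cases hp' : p = ⊤
  · subst hp'
    rw [vecNorm_top, vecNorm_top]
    have hM : 0 ≤ ⨆ i, |g i| := Real.iSup_nonneg fun _ => abs_nonneg _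
    refine Real.iSup_le (fun u => ?_) (mul_nonneg hc hM)
    rw [abs_of_nonneg (hpos u)]
    calc ∑ v, K u v * g v ≤ ∑ v, K u v * ⨆ i, |g i| :=
          Finset.sum_le_sum fun v _ => mul_le_mul_of_nonneg_left
            ((le_abs_self _).trans (abs_le_ciSup_abs g v)) (hK u v)
      _ = (∑ v, K u v) * ⨆ i, |g i| := by rw [Finset.sum_mul]
      _ ≤ _ := mul_le_mul_of_nonneg_right (hrow u) hM
  · have h1 := one_le_toReal hp hp'
    rw [vecNorm_of_ne_top hp hp', vecNorm_of_ne_top hp hp']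
    set q := p.toReal with hq
    have hq0 : 0 < q := by linarith
    -- Weighted Hölder in each row: the row sum supplies c ^ (q - 1). Summing over u then needs only
    -- the column sums, which supply the last factor c.
    have key : ∀ u, |∑ v, K u v * g v| ^ q ≤ c ^ (q - 1) * ∑ v, K u v * g v ^ q := by
      intro u
      rw [abs_of_nonneg (hpos u)]
      have hS : 0 ≤ ∑ v, K u v := Finset.sum_nonneg fun v _ => hK u v
      have hS' : 0 ≤ ∑ v, K u v * g v ^ q :=
        Finset.sum_nonneg fun v _ => mul_nonneg (hK u v) (Real.rpow_nonneg (hg v) _)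
      have := Real.rpow_le_rpow (hpos u)
        (Real.inner_le_weight_mul_Lp_of_nonneg Finset.univ h1 (K u) g (hK u) hg) hq0.le
      refine this.trans ?_
      rw [Real.mul_rpow (Real.rpow_nonneg hS _) (Real.rpow_nonneg hS' _), ← Real.rpow_mul hS,
        ← Real.rpow_mul hS', inv_mul_cancel₀ hq0.ne', Real.rpow_one, sub_mul, one_mul,
        inv_mul_cancel₀ hq0.ne']
      exact mul_le_mul_of_nonneg_right (Real.rpow_le_rpow hS (hrow u) (by linarith)) hS'
    have hG : 0 ≤ ∑ v, |g v| ^ q := Finset.sum_nonneg fun v _ => Real.rpow_nonneg (abs_nonneg _) _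
    have total : ∑ u, |∑ v, K u v * g v| ^ q ≤ c ^ q * ∑ v, |g v| ^ q := by
      calc ∑ u, |∑ v, K u v * g v| ^ q ≤ ∑ u, c ^ (q - 1) * ∑ v, K u v * g v ^ q :=
            Finset.sum_le_sum fun u _ => key u
        _ = c ^ (q - 1) * ∑ v, (∑ u, K u v) * g v ^ q := by
            rw [← Finset.mul_sum, Finset.sum_comm]
            simp only [Finset.sum_mul]
        _ ≤ c ^ (q - 1) * ∑ v, c * g v ^ q := by
            refine mul_le_mul_of_nonneg_left (Finset.sum_le_sum fun v _ => ?_)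
              (Real.rpow_nonneg hc _)
            exact mul_le_mul_of_nonneg_right (hcol v) (Real.rpow_nonneg (hg v) _)
        _ = (c ^ (q - 1) * c) * ∑ v, |g v| ^ q := by
            rw [← Finset.mul_sum, mul_assoc]
            simp only [abs_of_nonneg (hg _)]
        _ = c ^ q * ∑ v, |g v| ^ q := by
            congr 1
            have := Real.rpow_add_of_nonneg hc (sub_nonneg.2 h1) zero_le_one
            rw [Real.rpow_one] at this
            rw [← this]; congr 1; ring
    have h2 := Real.rpow_le_rpow
      (Finset.sum_nonneg fun u _ => Real.rpow_nonneg (abs_nonneg _) _) total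
      (z := 1 / q) (by positivity)
    rwa [Real.mul_rpow (Real.rpow_nonneg hc _) hG, ← Real.rpow_mul hc, mul_one_div_cancel hq0.ne',
      Real.rpow_one] at h2

end Norm

end CorrelationClustering

namespace CorrelationClustering

/-! ### The Jaccard distance and its relation to the disagreements of a clustering -/

section Charging

open Classical

variable {V : Type*} [Fintype V]

lemma mem_posNbhd {G : SimpleGraph V} {u v : V} : v ∈ posNbhd G u ↔ v = u ∨ G.Adj u v := by
  simp [posNbhd]

lemma mem_negNbhd {G : SimpleGraph V} {u v : V} : v ∈ negNbhd G u ↔ v ≠ u ∧ ¬ G.Adj u v := by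
  simp [negNbhd]

lemma mem_negNbhd_iff_notMem {G : SimpleGraph V} {u v : V} :
    v ∈ negNbhd G u ↔ v ∉ posNbhd G u := by
  simp [mem_posNbhd, mem_negNbhd]

lemma mem_posNbhd_comm {G : SimpleGraph V} {u v : V} : v ∈ posNbhd G u ↔ u ∈ posNbhd G v := by
  simp only [mem_posNbhd, G.adj_comm u v, eq_comm]

lemma self_mem_posNbhd (G : SimpleGraph V) (u : V) : u ∈ posNbhd G u := by simp [mem_posNbhd]

lemma card_posNbhd_pos (G : SimpleGraph V) (u : V) : (0 : ℚ) < (posNbhd G u).card :=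
  Nat.cast_pos.2 (Finset.card_pos.2 ⟨u, self_mem_posNbhd G u⟩)

lemma card_posNbhd_le_union (G : SimpleGraph V) (u v : V) :
    ((posNbhd G u).card : ℚ) ≤ ((posNbhd G u ∪ posNbhd G v).card : ℚ) :=
  Nat.cast_le.2 (Finset.card_le_card Finset.subset_union_left)

lemma card_union_posNbhd_pos (G : SimpleGraph V) (u v : V) :
    (0 : ℚ) < ((posNbhd G u ∪ posNbhd G v).card : ℚ) :=
  (card_posNbhd_pos G u).trans_le (card_posNbhd_le_union G u v)

lemma corrMetric_comm (G : SimpleGraph V) (u v : V) : corrMetric G u v = corrMetric G v u := by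
  simp only [corrMetric, Finset.inter_comm, Finset.union_comm]

lemma corrMetric_mul_card (G : SimpleGraph V) (u v : V) :
    corrMetric G u v * ((posNbhd G u ∪ posNbhd G v).card : ℚ) =
      ((posNbhd G u ∪ posNbhd G v).card : ℚ) - ((posNbhd G u ∩ posNbhd G v).card : ℚ) := by
  have := (card_union_posNbhd_pos G u v).ne'
  simp only [corrMetric]
  field_simp

lemma one_sub_corrMetric_mul_card (G : SimpleGraph V) (u v : V) :
    (1 - corrMetric G u v) * ((posNbhd G u ∪ posNbhd G v).card : ℚ) =
      ((posNbhd G u ∩ posNbhd G v).card : ℚ) := by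
  rw [sub_mul, corrMetric_mul_card]; ring

lemma corrMetric_self (G : SimpleGraph V) (u : V) : corrMetric G u u = 0 := by
  have := (card_posNbhd_pos G u).ne'
  simp [corrMetric, this]

lemma corrMetric_nonneg (G : SimpleGraph V) (u v : V) : 0 ≤ corrMetric G u v := by
  rw [corrMetric, sub_nonneg, div_le_one (card_union_posNbhd_pos G u v)]
  exact Nat.cast_le.2 (Finset.card_le_card
    (Finset.inter_subset_left.trans Finset.subset_union_left))

lemma corrMetric_le_one (G : SimpleGraph V) (u v : V) : corrMetric G u v ≤ 1 := by
  rw [corrMetric, sub_le_self_iff]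
  positivity

/-- This is the triangle inequality for Jaccard distances after all denominators are replaced by the
size of the triple union. It follows from inclusion-exclusion for the two unions and the two
intersections that involve B. -/
lemma card_union_triple {α : Type*} (A B C : Finset α) :
    (A ∪ B ∪ C).card + (A ∩ B).card + (B ∩ C).card ≤
      (A ∩ C).card + (A ∪ B).card + (B ∪ C).card := by
  have h1 := Finset.card_union_add_card_inter (A ∪ B) (B ∪ C)
  have h2 := Finset.card_union_add_card_inter (A ∩ B) (B ∩ C)
  have h3 : (A ∪ B ∪ C).card ≤ ((A ∪ B) ∪ (B ∪ C)).card := Finset.card_le_card (by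
    intro x; simp only [Finset.mem_union]; tauto)
  have h4 : B.card ≤ ((A ∪ B) ∩ (B ∪ C)).card := Finset.card_le_card (by
    intro x; simp only [Finset.mem_union, Finset.mem_inter]; tauto)
  have h5 : ((A ∩ B) ∪ (B ∩ C)).card ≤ B.card := Finset.card_le_card (by
    intro x; simp only [Finset.mem_union, Finset.mem_inter]; tauto)
  have h6 : ((A ∩ B) ∩ (B ∩ C)).card ≤ (A ∩ C).card := Finset.card_le_card (by
    intro x; simp only [Finset.mem_inter]; tauto)
  omega

/-- The triangle inequality for the Jaccard distance of positive neighborhoods. -/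
lemma corrMetric_triangle (G : SimpleGraph V) (u w v : V) :
    corrMetric G u v ≤ corrMetric G u w + corrMetric G w v := by
  set A := posNbhd G u
  set B := posNbhd G w
  set C := posNbhd G v
  have hU : (0 : ℚ) < ((A ∪ B ∪ C).card : ℚ) :=
    (card_union_posNbhd_pos G u w).trans_le
      (Nat.cast_le.2 (Finset.card_le_card Finset.subset_union_left))
  -- Enlarging the denominator decreases the size of the symmetric difference relative to it, the
  -- right direction for the two distances on the right-hand side.
  have hsub : ∀ x y : V, posNbhd G x ∪ posNbhd G y ⊆ A ∪ B ∪ C →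
      ((posNbhd G x ∪ posNbhd G y).card : ℚ) - ((posNbhd G x ∩ posNbhd G y).card : ℚ) ≤
        corrMetric G x y * ((A ∪ B ∪ C).card : ℚ) := fun x y h => by
    rw [← corrMetric_mul_card]
    exact mul_le_mul_of_nonneg_left (Nat.cast_le.2 (Finset.card_le_card h))
      (corrMetric_nonneg G x y)
  have h1 := hsub u w Finset.subset_union_left
  have h2 := hsub w v (by rw [Finset.union_assoc]; exact Finset.subset_union_right)
  -- For the distance on the left the similarity is what shrinks under the larger denominator, which
  -- leaves the triple union minus `A ∩ C`.
  have h3 : corrMetric G u v * ((A ∪ B ∪ C).card : ℚ) ≤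
      ((A ∪ B ∪ C).card : ℚ) - ((A ∩ C).card : ℚ) := by
    have e := one_sub_corrMetric_mul_card G u v
    have : (1 - corrMetric G u v) * ((A ∪ C).card : ℚ) ≤
        (1 - corrMetric G u v) * ((A ∪ B ∪ C).card : ℚ) :=
      mul_le_mul_of_nonneg_left (Nat.cast_le.2 (Finset.card_le_card (by
        intro x; simp only [Finset.mem_union]; tauto))) (by linarith [corrMetric_le_one G u v])
    linarith
  have h4 : ((A ∪ B ∪ C).card : ℚ) + (A ∩ B).card + (B ∩ C).card ≤
      (A ∩ C).card + (A ∪ B).card + (B ∪ C).card := by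
    exact_mod_cast card_union_triple A B C
  refine le_of_mul_le_mul_right ?_ hU
  rw [add_mul]
  linarith

lemma adjCorrMetric_self (G : SimpleGraph V) (u : V) : adjCorrMetric G u u = 0 := by
  simp [adjCorrMetric]

lemma corrMetric_le_adjCorrMetric (G : SimpleGraph V) (u v : V) :
    corrMetric G u v ≤ adjCorrMetric G u v := by
  have := corrMetric_le_one G u v
  unfold adjCorrMetric
  split_ifs with h
  · rw [h, corrMetric_self]
  all_goals linarith

lemma adjCorrMetric_le_one (G : SimpleGraph V) (u v : V) : adjCorrMetric G u v ≤ 1 := by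
  have := corrMetric_le_one G u v
  unfold adjCorrMetric
  split_ifs <;> linarith

lemma adjCorrMetric_nonneg (G : SimpleGraph V) (u v : V) : 0 ≤ adjCorrMetric G u v :=
  (corrMetric_nonneg G u v).trans (corrMetric_le_adjCorrMetric G u v)

/-- The fractional cost of the pair `u`, `v` for the adjusted correlation metric. -/
noncomputable def pairCost (G : SimpleGraph V) (u v : V) : ℚ :=
  if u = v then 0 else if G.Adj u v then adjCorrMetric G u v else 1 - adjCorrMetric G u v

/-- The fractional cost of the vertex `u` for the adjusted correlation metric. -/
noncomputable def fracCost (G : SimpleGraph V) (u : V) : ℚ := ∑ v, pairCost G u v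

lemma pairCost_nonneg (G : SimpleGraph V) (u v : V) : 0 ≤ pairCost G u v := by
  have h1 := adjCorrMetric_nonneg G u v
  have h2 := adjCorrMetric_le_one G u v
  unfold pairCost
  split_ifs <;> linarith

lemma fracCost_nonneg (G : SimpleGraph V) (u : V) : 0 ≤ fracCost G u :=
  Finset.sum_nonneg fun v _ => pairCost_nonneg G u v

/-- The other endpoints of the disagreements incident to `u`. -/
noncomputable def disagreementSet (G : SimpleGraph V) (C : Setoid V) (u : V) : Finset V :=
  Finset.univ.filter fun v => u ≠ v ∧ ((G.Adj u v ∧ ¬ C u v) ∨ (¬ G.Adj u v ∧ C u v))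

lemma mem_disagreementSet {G : SimpleGraph V} {C : Setoid V} {u v : V} :
    v ∈ disagreementSet G C u ↔ u ≠ v ∧ ((G.Adj u v ∧ ¬ C u v) ∨ (¬ G.Adj u v ∧ C u v)) := by
  simp [disagreementSet]

lemma card_disagreementSet (G : SimpleGraph V) (C : Setoid V) (u : V) :
    (disagreementSet G C u).card = disagreements G C u := rfl

/-- A vertex w that is positive for exactly one of u and v is a disagreement at one of them, because
C puts w either with both or with neither. -/
lemma card_union_le_of_rel (G : SimpleGraph V) (C : Setoid V) {u v : V} (h : C u v) :
    ((posNbhd G u ∪ posNbhd G v).card : ℚ) ≤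
      (posNbhd G u ∩ posNbhd G v).card + (disagreements G C u + disagreements G C v) := by
  have hsub : posNbhd G u ∪ posNbhd G v ⊆
      (posNbhd G u ∩ posNbhd G v) ∪ (disagreementSet G C u ∪ disagreementSet G C v) := by
    intro w hw
    simp only [Finset.mem_union, Finset.mem_inter, mem_posNbhd, mem_disagreementSet] at hw ⊢
    have huv : C u w ↔ C v w := ⟨C.trans (C.symm h), C.trans h⟩
    have h1 : w = u → C u w := fun e => e ▸ C.refl _
    have h2 : w = v → C v w := fun e => e ▸ C.refl _
    by_cases e1 : w = u <;> by_cases e2 : w = v <;> by_cases hC : C u w <;>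
      by_cases a1 : G.Adj u w <;> by_cases a2 : G.Adj v w <;> simp_all [eq_comm]
  have := (Finset.card_le_card hsub).trans
    ((Finset.card_union_le _ _).trans (Nat.add_le_add_left (Finset.card_union_le _ _) _))
  exact_mod_cast this

/-- A common positive neighbor cannot share a cluster with both u and v, so it is cut off from one
of them. -/
lemma card_inter_le_of_not_rel (G : SimpleGraph V) (C : Setoid V) {u v : V} (h : ¬ C u v) :
    ((posNbhd G u ∩ posNbhd G v).card : ℚ) ≤ disagreements G C u + disagreements G C v := by
  have hsub : posNbhd G u ∩ posNbhd G v ⊆ disagreementSet G C u ∪ disagreementSet G C v := by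
    intro w hw
    simp only [Finset.mem_union, Finset.mem_inter, mem_posNbhd, mem_disagreementSet] at hw ⊢
    have huv : C u w → ¬ C v w := fun h1 h2 => h (C.trans h1 (C.symm h2))
    have h1 : w = u → C u w := fun e => e ▸ C.refl _
    have h2 : w = v → C v w := fun e => e ▸ C.refl _
    by_cases e1 : w = u <;> by_cases e2 : w = v <;> by_cases hC : C u w <;>
      by_cases a1 : G.Adj u w <;> by_cases a2 : G.Adj v w <;> simp_all [eq_comm]
  have := (Finset.card_le_card hsub).trans (Finset.card_union_le _ _)
  exact_mod_cast this

end Charging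

end CorrelationClustering

namespace CorrelationClustering

/-! ### Bounding the fractional cost by the cost of an arbitrary clustering -/

section Kernels

open Classical

variable {V : Type*} [Fintype V]

/-- The weight with which positive neighbors charge each other. -/
noncomputable def posKernel (G : SimpleGraph V) (u v : V) : ℚ :=
  if v ∈ posNbhd G u then 1 / max ((posNbhd G u).card : ℚ) (posNbhd G v).card else 0

/-- The weight with which close negative neighbors charge each other. -/
noncomputable def negKernel (G : SimpleGraph V) (u v : V) : ℚ :=
  if v ∈ negNbhd G u ∧ corrMetric G u v ≤ 7 / 10 ∧ ¬ IsIsolated G u ∧ ¬ IsIsolated G v then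
    1 / ((posNbhd G u ∪ posNbhd G v).card : ℚ) else 0

/-- The weight with which isolated vertices charge the members of their clusters. -/
noncomputable def isoKernel (G : SimpleGraph V) (C : Setoid V) (u w : V) : ℚ :=
  if IsIsolated G u ∧ 10 * (disagreements G C u : ℚ) ≤ (posNbhd G u).card ∧
      w ∈ posNbhd G u ∧ C u w then 1 / ((posNbhd G u).card : ℚ) else 0

/-- An upper bound for the positive degree of isolated vertices. -/
noncomputable def isoCharge (G : SimpleGraph V) (C : Setoid V) (u : V) : ℚ :=
  10 * disagreements G C u + 2 * ∑ w, isoKernel G C u w * disagreements G C w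

lemma posKernel_comm (G : SimpleGraph V) (u v : V) : posKernel G u v = posKernel G v u := by
  simp only [posKernel, mem_posNbhd_comm (u := u) (v := v), max_comm]

lemma negKernel_comm (G : SimpleGraph V) (u v : V) : negKernel G u v = negKernel G v u := by
  have h : v ∈ negNbhd G u ↔ u ∈ negNbhd G v := by
    simp only [mem_negNbhd_iff_notMem, mem_posNbhd_comm (u := u) (v := v)]
  simp only [negKernel, corrMetric_comm G u v, h, Finset.union_comm,
    and_comm (a := ¬ IsIsolated G u)]

lemma posKernel_nonneg (G : SimpleGraph V) (u v : V) : 0 ≤ posKernel G u v := by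
  unfold posKernel; split_ifs <;> positivity

lemma negKernel_nonneg (G : SimpleGraph V) (u v : V) : 0 ≤ negKernel G u v := by
  unfold negKernel; split_ifs <;> positivity

lemma isoKernel_nonneg (G : SimpleGraph V) (C : Setoid V) (u v : V) : 0 ≤ isoKernel G C u v := by
  unfold isoKernel; split_ifs <;> positivity

lemma sum_le_of_supported {α : Type*} [Fintype α] (s : Finset α) (f : α → ℚ) {b c : ℚ}
    (hb : 0 < b) (hc : (s.card : ℚ) ≤ c * b) (hs : ∀ x ∉ s, f x = 0) (hf : ∀ x ∈ s, f x ≤ 1 / b) :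
    ∑ x, f x ≤ c := by
  calc ∑ x, f x = ∑ x ∈ s, f x := (Finset.sum_subset s.subset_univ fun x _ h => hs x h).symm
    _ ≤ ∑ _x ∈ s, 1 / b := Finset.sum_le_sum hf
    _ = s.card / b := by rw [Finset.sum_const, nsmul_eq_mul, mul_one_div]
    _ ≤ c := (div_le_iff₀ hb).2 hc

lemma sum_posKernel_le (G : SimpleGraph V) (u : V) : ∑ v, posKernel G u v ≤ 1 := by
  refine sum_le_of_supported (posNbhd G u) _ (card_posNbhd_pos G u) (by rw [one_mul])
    (fun v hv => if_neg hv) fun v hv => ?_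
  rw [posKernel, if_pos hv]
  exact one_div_le_one_div_of_le (card_posNbhd_pos G u) (le_max_left _ _)

/-- The row of a vertex that is not isolated has fewer than 10/3 times its positive degree many
nonzero entries, each at most the inverse of that degree; other rows vanish. -/
lemma sum_negKernel_le (G : SimpleGraph V) (u : V) : ∑ v, negKernel G u v ≤ 10 / 3 := by
  by_cases hu : IsIsolated G u
  · simp [negKernel, hu]; norm_num
  have h := hu
  rw [IsIsolated, not_le] at h
  refine sum_le_of_supported _ _ (card_posNbhd_pos G u) h.le (fun v hv => ?_) fun v _ => ?_
  · refine if_neg fun hv' => hv ?_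
    simp only [Finset.mem_filter]
    exact ⟨hv'.1, hv'.2.1⟩
  · unfold negKernel
    split_ifs
    · exact one_div_le_one_div_of_le (card_posNbhd_pos G u) (card_posNbhd_le_union G u v)
    · positivity

lemma sum_isoKernel_le (G : SimpleGraph V) (C : Setoid V) (u : V) :
    ∑ w, isoKernel G C u w ≤ 1 := by
  refine sum_le_of_supported (posNbhd G u) _ (card_posNbhd_pos G u) (by rw [one_mul])
    (fun v hv => if_neg fun h => hv h.2.2.1) fun v _ => ?_
  unfold isoKernel
  split_ifs
  · exact le_rfl
  · positivity

/-- Only members u of the cluster of w contribute. That cluster has at most as many elements as the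
positive neighborhood of u plus the disagreements of u, so at most 11/10 times the former. -/
lemma sum_isoKernel_le' (G : SimpleGraph V) (C : Setoid V) (w : V) :
    ∑ u, isoKernel G C u w ≤ 11 / 10 := by
  have hw : (0 : ℚ) < (Finset.univ.filter fun v => C w v).card :=
    Nat.cast_pos.2 (Finset.card_pos.2 ⟨w, by simp⟩)
  refine sum_le_of_supported (Finset.univ.filter fun v => C w v) _
    (b := 10 / 11 * (Finset.univ.filter fun v => C w v).card) (by positivity)
    (by linarith) (fun v hv => if_neg fun h => hv (by simpa using C.symm h.2.2.2)) fun v _ => ?_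
  unfold isoKernel
  split_ifs with h
  · refine one_div_le_one_div_of_le (by positivity) ?_
    have hsub : (Finset.univ.filter fun x => C w x) ⊆ posNbhd G v ∪ disagreementSet G C v := by
      intro x hx
      have hvx : C v x := C.trans h.2.2.2 (by simpa using hx)
      simp only [Finset.mem_union, mem_posNbhd, mem_disagreementSet]
      by_cases e : x = v
      · exact Or.inl (Or.inl e)
      · by_cases a : G.Adj v x
        · exact Or.inl (Or.inr a)
        · exact Or.inr ⟨fun h => e h.symm, Or.inr ⟨a, hvx⟩⟩
    have h1 : ((Finset.univ.filter fun x => C w x).card : ℚ) ≤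
        (posNbhd G v).card + disagreements G C v := by
      exact_mod_cast (Finset.card_le_card hsub).trans (Finset.card_union_le _ _)
    linarith [h.2.1]
  · positivity

/-- If u has few disagreements, most of its close negative neighbors lie outside its cluster, and
each of them has many positive neighbors inside. These crossing positive edges are disagreements at
positive neighbors of u in the cluster. -/
lemma card_posNbhd_le_isoCharge {G : SimpleGraph V} (C : Setoid V) {u : V} (hu : IsIsolated G u) :
    ((posNbhd G u).card : ℚ) ≤ isoCharge G C u := by
  have ha := card_posNbhd_pos G u
  have hK : 0 ≤ ∑ w, isoKernel G C u w * disagreements G C w :=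
    Finset.sum_nonneg fun w _ => mul_nonneg (isoKernel_nonneg G C u w) (Nat.cast_nonneg _)
  have hD0 : (0 : ℚ) ≤ disagreements G C u := Nat.cast_nonneg _
  unfold isoCharge
  -- If this fails, the summand 10 D u alone is large enough.
  by_cases hD : 10 * (disagreements G C u : ℚ) ≤ (posNbhd G u).card
  swap
  · linarith
  set a : ℚ := ((posNbhd G u).card : ℚ) with ha_def
  set W := (posNbhd G u).filter fun w => C u w
  have hsum : ∑ w, isoKernel G C u w * disagreements G C w =
      (∑ w ∈ W, (disagreements G C w : ℚ)) / a := by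
    rw [Finset.sum_div, Finset.sum_filter, ← Finset.sum_subset (posNbhd G u).subset_univ]
    · refine Finset.sum_congr rfl fun w hw => ?_
      by_cases hC : C u w
      · rw [if_pos hC, isoKernel, if_pos ⟨hu, hD, hw, hC⟩, ← ha_def]; ring
      · rw [if_neg hC, isoKernel, if_neg (by tauto)]; simp
    · intro w _ hw
      rw [isoKernel, if_neg (by tauto), zero_mul]
  set X := (negNbhd G u).filter fun v => corrMetric G u v ≤ 7 / 10
  set Y := X.filter fun v => ¬ C u v
  have hX : 10 / 3 * a ≤ (X.card : ℚ) := hu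
  have hXY : (X.card : ℚ) ≤ Y.card + disagreements G C u := by
    have : X ⊆ Y ∪ disagreementSet G C u := by
      intro x hx
      have hx' := mem_negNbhd.1 (Finset.mem_filter.1 hx).1
      by_cases hC : C u x
      · exact Finset.mem_union_right _
          (mem_disagreementSet.2 ⟨fun e => hx'.1 e.symm, Or.inr ⟨hx'.2, hC⟩⟩)
      · exact Finset.mem_union_left _ (Finset.mem_filter.2 ⟨hx, hC⟩)
    exact_mod_cast (Finset.card_le_card this).trans (Finset.card_union_le _ _)
  -- Distance at most 7/10 gives 3a/10 common neighbors; at most a/10 of them are separated from u.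
  have hinter : ∀ v ∈ Y, a / 5 ≤ ((W.filter fun w => w ∈ posNbhd G v).card : ℚ) := by
    intro v hv
    have hd : corrMetric G u v ≤ 7 / 10 := (Finset.mem_filter.1 (Finset.mem_filter.1 hv).1).2
    have h1 := one_sub_corrMetric_mul_card G u v
    have h2 : 3 / 10 * a ≤ (1 - corrMetric G u v) * ((posNbhd G u ∪ posNbhd G v).card : ℚ) :=
      mul_le_mul (by linarith) (card_posNbhd_le_union G u v) ha.le (by linarith)
    have h3 : ((posNbhd G u ∩ posNbhd G v).card : ℚ) ≤
        (W.filter fun w => w ∈ posNbhd G v).card + disagreements G C u := by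
      have : posNbhd G u ∩ posNbhd G v ⊆
          (W.filter fun w => w ∈ posNbhd G v) ∪ disagreementSet G C u := by
        intro x hx
        have hx' := Finset.mem_inter.1 hx
        by_cases hC : C u x
        · exact Finset.mem_union_left _
            (Finset.mem_filter.2 ⟨Finset.mem_filter.2 ⟨hx'.1, hC⟩, hx'.2⟩)
        · have hne : x ≠ u := fun e => hC (e ▸ C.refl _)
          have hadj : G.Adj u x := (mem_posNbhd.1 hx'.1).resolve_left hne
          exact Finset.mem_union_right _
            (mem_disagreementSet.2 ⟨hne.symm, Or.inl ⟨hadj, hC⟩⟩)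
      exact_mod_cast (Finset.card_le_card this).trans (Finset.card_union_le _ _)
    linarith
  have hcount : ∑ v ∈ Y, (W.filter fun w => w ∈ posNbhd G v).card ≤
      ∑ w ∈ W, disagreements G C w := by
    have := Finset.sum_card_bipartiteAbove_eq_sum_card_bipartiteBelow (s := W) (t := Y)
      (fun w v => w ∈ posNbhd G v)
    simp only [Finset.bipartiteBelow, Finset.bipartiteAbove] at this
    rw [← this]
    refine Finset.sum_le_sum fun w hw => ?_
    rw [← card_disagreementSet]
    refine Finset.card_le_card fun v hv => ?_
    rw [Finset.mem_filter] at hv hw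
    have hCv := (Finset.mem_filter.1 hv.1).2
    have hCwv : ¬ C w v := fun h => hCv (C.trans hw.2 h)
    have hne : w ≠ v := fun e => hCwv (e ▸ C.refl _)
    exact mem_disagreementSet.2
      ⟨hne, Or.inl ⟨((mem_posNbhd.1 hv.2).resolve_left hne).symm, hCwv⟩⟩
  have hcount' : ((Y.card : ℚ) * (a / 5)) ≤ ∑ w ∈ W, (disagreements G C w : ℚ) := by
    calc ((Y.card : ℚ) * (a / 5)) = ∑ _v ∈ Y, a / 5 := by rw [Finset.sum_const, nsmul_eq_mul]
      _ ≤ ∑ v ∈ Y, ((W.filter fun w => w ∈ posNbhd G v).card : ℚ) := Finset.sum_le_sum hinter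
      _ ≤ _ := by exact_mod_cast hcount
  -- Here 97/30 = 10/3 - 1/10. Multiplied by a/5 it yields more than a²/2 crossing edges, whence the
  -- factor 2 in `isoCharge`.
  have hYa : 97 / 30 * a ≤ Y.card := by linarith
  have : a ≤ 2 * ((∑ w ∈ W, (disagreements G C w : ℚ)) / a) := by
    rw [mul_div_assoc', le_div_iff₀ ha]
    nlinarith
  rw [hsum]
  linarith

lemma disagreements_le_isoCharge (G : SimpleGraph V) (C : Setoid V) (u : V) :
    (disagreements G C u : ℚ) ≤ isoCharge G C u := by
  have hK : 0 ≤ ∑ w, isoKernel G C u w * disagreements G C w :=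
    Finset.sum_nonneg fun w _ => mul_nonneg (isoKernel_nonneg G C u w) (Nat.cast_nonneg _)
  have hD0 : (0 : ℚ) ≤ disagreements G C u := Nat.cast_nonneg _
  unfold isoCharge
  linarith

/-- The degree of v is controlled although only u is isolated: within a cluster the two
neighborhoods differ only by disagreements. -/
lemma max_card_le_of_isIsolated {G : SimpleGraph V} {C : Setoid V} {u v : V}
    (hu : IsIsolated G u) (hC : C u v) :
    max ((posNbhd G u).card : ℚ) (posNbhd G v).card ≤
      2 * (isoCharge G C u + isoCharge G C v) := by
  have h1 := card_posNbhd_le_isoCharge C hu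
  have h2 := disagreements_le_isoCharge G C u
  have h3 := disagreements_le_isoCharge G C v
  have h4 := card_union_le_of_rel G C hC
  have h5 : ((posNbhd G u ∩ posNbhd G v).card : ℚ) ≤ (posNbhd G u).card :=
    Nat.cast_le.2 (Finset.card_le_card Finset.inter_subset_left)
  have h6 := card_posNbhd_le_union G v u
  rw [Finset.union_comm] at h6
  have h7 : (0 : ℚ) ≤ disagreements G C v := Nat.cast_nonneg _
  have h8 := card_posNbhd_pos G u
  refine max_le (by linarith) ?_
  linarith

lemma le_div_mul_of_le {m x : ℚ} (hm : 0 < m) (h : m ≤ x) : 1 ≤ 1 / m * x := by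
  rw [one_div_mul_eq_div]; exact (one_le_div hm).2 h

/-- The cost of a pair is charged to the disagreements of a fixed clustering. -/
lemma pairCost_le (G : SimpleGraph V) (C : Setoid V) (u v : V) :
    pairCost G u v ≤ (if v ∈ disagreementSet G C u then 1 else 0) +
      (posKernel G u v + negKernel G u v) * (disagreements G C u + disagreements G C v) +
      2 * posKernel G u v * (isoCharge G C u + isoCharge G C v) := by
  have hp := posKernel_nonneg G u v
  have hn := negKernel_nonneg G u v
  have hDu : (0 : ℚ) ≤ disagreements G C u := Nat.cast_nonneg _
  have hDv : (0 : ℚ) ≤ disagreements G C v := Nat.cast_nonneg _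
  have hHu := hDu.trans (disagreements_le_isoCharge G C u)
  have hHv := hDv.trans (disagreements_le_isoCharge G C v)
  have t1 : 0 ≤ (posKernel G u v + negKernel G u v) *
      (disagreements G C u + disagreements G C v) := by positivity
  have t2 : 0 ≤ 2 * posKernel G u v * (isoCharge G C u + isoCharge G C v) := by positivity
  have hU := card_union_posNbhd_pos G u v
  have hle1 : pairCost G u v ≤ 1 := by
    have h1 := adjCorrMetric_nonneg G u v
    have h2 := adjCorrMetric_le_one G u v
    unfold pairCost
    split_ifs <;> linarith
  by_cases hmem : v ∈ disagreementSet G C u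
  · rw [if_pos hmem]; linarith
  rw [if_neg hmem, zero_add]
  by_cases huv : u = v
  · rw [pairCost, if_pos huv]; linarith
  have hmem' : ¬ ((G.Adj u v ∧ ¬ C u v) ∨ (¬ G.Adj u v ∧ C u v)) := fun h =>
    hmem (mem_disagreementSet.2 ⟨huv, h⟩)
  by_cases hadj : G.Adj u v
  · have hC : C u v := by tauto
    have hpos : v ∈ posNbhd G u := mem_posNbhd.2 (Or.inr hadj)
    have hm : (0 : ℚ) < max ((posNbhd G u).card : ℚ) (posNbhd G v).card :=
      lt_max_of_lt_left (card_posNbhd_pos G u)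
    have hk : posKernel G u v = 1 / max ((posNbhd G u).card : ℚ) (posNbhd G v).card := by
      rw [posKernel, if_pos hpos]
    -- An edge at an isolated vertex costs 1, which is paid in full since the larger of the two
    -- degrees is bounded by the charges.
    by_cases hiso : IsIsolated G u ∨ IsIsolated G v
    · have hmax : max ((posNbhd G u).card : ℚ) (posNbhd G v).card ≤
          2 * (isoCharge G C u + isoCharge G C v) := by
        rcases hiso with h | h
        · exact max_card_le_of_isIsolated h hC
        · rw [max_comm, add_comm (isoCharge G C u)]
          exact max_card_le_of_isIsolated h (C.symm hC)
      have := le_div_mul_of_le hm hmax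
      rw [← hk] at this
      linarith
    · have hd : pairCost G u v = corrMetric G u v := by
        rw [pairCost, if_neg huv, if_pos hadj, adjCorrMetric, if_neg huv, if_neg hiso,
          if_neg (by tauto)]
      have h1 := corrMetric_mul_card G u v
      have h2 := card_union_le_of_rel G C hC
      have h3 : max ((posNbhd G u).card : ℚ) (posNbhd G v).card ≤
          ((posNbhd G u ∪ posNbhd G v).card : ℚ) :=
        max_le (card_posNbhd_le_union G u v)
          (by rw [Finset.union_comm]; exact card_posNbhd_le_union G v u)
      have h4 : corrMetric G u v ≤ posKernel G u v * (disagreements G C u + disagreements G C v) := by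
        rw [hk, one_div_mul_eq_div, le_div_iff₀ hm]
        exact (mul_le_mul_of_nonneg_left h3 (corrMetric_nonneg G u v)).trans (by linarith)
      have h5 : 0 ≤ negKernel G u v * (disagreements G C u + disagreements G C v) := by positivity
      rw [hd, add_mul]
      linarith
  · have hC : ¬ C u v := by tauto
    have hpc : pairCost G u v = 1 - adjCorrMetric G u v := by
      rw [pairCost, if_neg huv, if_neg hadj]
    -- A negative pair rounded up to distance 1 costs nothing, so only the pairs in the support of
    -- `negKernel` remain.
    by_cases hiso : IsIsolated G u ∨ IsIsolated G v
    · rw [hpc, adjCorrMetric, if_neg huv, if_pos hiso]; linarith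
    by_cases hfar : 7 / 10 < corrMetric G u v
    · rw [hpc, adjCorrMetric, if_neg huv, if_neg hiso, if_pos ⟨hadj, hfar⟩]; linarith
    · rw [hpc, adjCorrMetric, if_neg huv, if_neg hiso, if_neg (by tauto)]
      have hk : negKernel G u v = 1 / ((posNbhd G u ∪ posNbhd G v).card : ℚ) := by
        rw [negKernel, if_pos ⟨mem_negNbhd.2 ⟨Ne.symm huv, hadj⟩, not_lt.1 hfar, by tauto⟩]
      have h1 := one_sub_corrMetric_mul_card G u v
      have h2 := card_inter_le_of_not_rel G C hC
      have h4 : 1 - corrMetric G u v ≤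
          negKernel G u v * (disagreements G C u + disagreements G C v) := by
        rw [hk, one_div_mul_eq_div, le_div_iff₀ hU]
        linarith
      have h5 : 0 ≤ posKernel G u v * (disagreements G C u + disagreements G C v) := by positivity
      rw [add_mul]
      linarith

/-- Summing the pair bounds over v leaves row sums in front of the terms at u: 16/3 = 1 + 1 + 10/3
collects the disagreements themselves and the two kernels. -/
lemma fracCost_le (G : SimpleGraph V) (C : Setoid V) (u : V) :
    fracCost G u ≤ 16 / 3 * disagreements G C u +
      ∑ v, posKernel G u v * disagreements G C v + ∑ v, negKernel G u v * disagreements G C v +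
      2 * isoCharge G C u + 2 * ∑ v, posKernel G u v * isoCharge G C v := by
  have hDu : (0 : ℚ) ≤ disagreements G C u := Nat.cast_nonneg _
  have hHu := hDu.trans (disagreements_le_isoCharge G C u)
  have h1 : ∑ v, (if v ∈ disagreementSet G C u then (1 : ℚ) else 0) = disagreements G C u := by
    rw [Finset.sum_boole, ← card_disagreementSet]
    simp
  have h2 := mul_le_mul_of_nonneg_right (sum_posKernel_le G u) hDu
  have h3 := mul_le_mul_of_nonneg_right (sum_negKernel_le G u) hDu
  have h4 := mul_le_mul_of_nonneg_right (sum_posKernel_le G u) hHu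
  have := Finset.sum_le_sum fun v (_ : v ∈ Finset.univ) => pairCost_le G C u v
  simp only [mul_add, add_mul, Finset.sum_add_distrib, mul_assoc, ← Finset.mul_sum,
    ← Finset.sum_mul, h1] at this
  rw [fracCost]
  linarith

/-- The fractional cost is within a constant factor of the cost of every clustering. -/
lemma vecNorm_fracCost_le {p : ENNReal} (hp : 1 ≤ p) (G : SimpleGraph V) (C : Setoid V) :
    vecNorm p (fun u => (fracCost G u : ℝ)) ≤ 60 * cost G p C := by
  set D : V → ℝ := fun u => (disagreements G C u : ℝ) with hD
  set H : V → ℝ := fun u => (isoCharge G C u : ℝ) with hH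
  have hD0 : ∀ u, 0 ≤ D u := fun u => Nat.cast_nonneg _
  have hDH : ∀ u, D u ≤ H u := fun u => by
    have := disagreements_le_isoCharge G C u
    simp only [hD, hH]
    exact_mod_cast this
  have hH0 : ∀ u, 0 ≤ H u := fun u => (hD0 u).trans (hDH u)
  have hcost : cost G p C = vecNorm p D := rfl
  have hN : 0 ≤ vecNorm p D := by
    have := vecNorm_mono (p := p) hp (f := fun _ : V => 0) (g := D) (fun _ => le_rfl) hD0
    have h0 := vecNorm_smul (p := p) hp (c := 0) le_rfl D
    simp only [zero_mul] at h0
    linarith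
  have hpos : ∀ {g : V → ℝ}, (∀ v, 0 ≤ g v) →
      vecNorm p (fun u => ∑ v, (posKernel G u v : ℝ) * g v) ≤ 1 * vecNorm p g := fun hg =>
    vecNorm_kernel_le hp zero_le_one
      (fun u v => by exact_mod_cast posKernel_nonneg G u v)
      (fun u => by exact_mod_cast sum_posKernel_le G u)
      (fun v => by simp only [posKernel_comm G _ v]; exact_mod_cast sum_posKernel_le G v) hg
  have hneg : vecNorm p (fun u => ∑ v, (negKernel G u v : ℝ) * D v) ≤ (10 / 3 : ℚ) * vecNorm p D :=
    vecNorm_kernel_le hp (by norm_num)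
      (fun u v => by exact_mod_cast negKernel_nonneg G u v)
      (fun u => by exact_mod_cast sum_negKernel_le G u)
      (fun v => by simp only [negKernel_comm G _ v]; exact_mod_cast sum_negKernel_le G v) hD0
  have hiso : vecNorm p (fun u => ∑ v, (isoKernel G C u v : ℝ) * D v) ≤
      (11 / 10 : ℚ) * vecNorm p D :=
    vecNorm_kernel_le hp (by norm_num)
      (fun u v => by exact_mod_cast isoKernel_nonneg G C u v)
      (fun u => by exact_mod_cast (sum_isoKernel_le G C u).trans (by norm_num))
      (fun v => by exact_mod_cast sum_isoKernel_le' G C v) hD0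
  -- 61/5 = 10 + 2 · 11/10.
  have hHn : vecNorm p H ≤ 61 / 5 * vecNorm p D := by
    have e : H = fun u => 10 * D u + 2 * ∑ w, (isoKernel G C u w : ℝ) * D w := by
      funext u
      simp only [hH, hD, isoCharge]
      push_cast
      rfl
    rw [e]
    refine (vecNorm_add_le hp _ _).trans ?_
    rw [vecNorm_smul hp (by norm_num), vecNorm_smul hp (by norm_num)]
    push_cast at hiso
    linarith
  have hle : ∀ u, (fracCost G u : ℝ) ≤ 16 / 3 * D u + ∑ v, (posKernel G u v : ℝ) * D v +
      ∑ v, (negKernel G u v : ℝ) * D v + 2 * H u + 2 * ∑ v, (posKernel G u v : ℝ) * H v := by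
    intro u
    have := fracCost_le G C u
    have h : ((fracCost G u : ℚ) : ℝ) ≤ ((16 / 3 * disagreements G C u +
      ∑ v, posKernel G u v * disagreements G C v + ∑ v, negKernel G u v * disagreements G C v +
      2 * isoCharge G C u + 2 * ∑ v, posKernel G u v * isoCharge G C v : ℚ) : ℝ) := by
      exact_mod_cast this
    push_cast at h
    exact h
  -- The total is 16/3 + 1 + 10/3 + (2 + 2) · 61/5, which is below 60.
  refine (vecNorm_mono hp (fun u => by exact_mod_cast fracCost_nonneg G u) hle).trans ?_
  refine (vecNorm_add_le hp _ _).trans ?_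
  have a1 := vecNorm_add_le hp (fun u => 16 / 3 * D u + ∑ v, (posKernel G u v : ℝ) * D v +
      ∑ v, (negKernel G u v : ℝ) * D v) (fun u => 2 * H u)
  have a2 := vecNorm_add_le hp (fun u => 16 / 3 * D u + ∑ v, (posKernel G u v : ℝ) * D v)
      (fun u => ∑ v, (negKernel G u v : ℝ) * D v)
  have a3 := vecNorm_add_le hp (fun u => 16 / 3 * D u)
      (fun u => ∑ v, (posKernel G u v : ℝ) * D v)
  rw [vecNorm_smul hp (by norm_num)] at a1 a3
  rw [vecNorm_smul hp (by norm_num), hcost]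
  have b1 := hpos hD0
  have b2 := hpos hH0
  push_cast at hneg
  linarith

end Kernels

end CorrelationClustering

namespace CorrelationClustering

/-! ### Disagreements of the rounded clustering against the fractional cost -/

section RoundingAnalysis

open Classical

variable {V : Type*} [Fintype V]

lemma adjCorrMetric_eq_corrMetric {G : SimpleGraph V} {u v : V} (hu : ¬ IsIsolated G u)
    (hv : ¬ IsIsolated G v) (h : G.Adj u v ∨ corrMetric G u v ≤ 7 / 10) :
    adjCorrMetric G u v = corrMetric G u v := by
  by_cases e : u = v
  · rw [e, adjCorrMetric_self, corrMetric_self]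
  · rw [adjCorrMetric, if_neg e, if_neg (by tauto), if_neg]
    rintro ⟨h1, h2⟩
    rcases h with h | h
    · exact h1 h
    · linarith

lemma adjCorrMetric_eq_one_of_isIsolated {G : SimpleGraph V} {u v : V} (huv : u ≠ v)
    (h : IsIsolated G u ∨ IsIsolated G v) : adjCorrMetric G u v = 1 := by
  rw [adjCorrMetric, if_neg huv, if_pos h]

/-- A value below 1 shows that no rounding up took place, so inside a cluster with a center that is
not isolated the triangle inequality is available. -/
lemma of_adjCorrMetric_lt_one {G : SimpleGraph V} {u v : V} (hu : ¬ IsIsolated G u)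
    (h : adjCorrMetric G u v < 1) :
    ¬ IsIsolated G v ∧ adjCorrMetric G u v = corrMetric G u v := by
  by_cases e : u = v
  · subst e; exact ⟨hu, by rw [adjCorrMetric_self, corrMetric_self]⟩
  · have hv : ¬ IsIsolated G v := fun hv =>
      h.ne (adjCorrMetric_eq_one_of_isIsolated e (Or.inr hv))
    refine ⟨hv, ?_⟩
    unfold adjCorrMetric at h ⊢
    split_ifs at h ⊢ <;> first | rfl | exact absurd h (lt_irrefl _)

lemma pairCost_of_adj {G : SimpleGraph V} {u v : V} (h : G.Adj u v) :
    pairCost G u v = adjCorrMetric G u v := by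
  rw [pairCost, if_neg h.ne, if_pos h]

lemma pairCost_of_not_adj {G : SimpleGraph V} {u v : V} (huv : u ≠ v) (h : ¬ G.Adj u v) :
    pairCost G u v = 1 - adjCorrMetric G u v := by
  rw [pairCost, if_neg huv, if_neg h]

lemma sum_corrMetric_le_fracCost (G : SimpleGraph V) (u : V) :
    ∑ x ∈ posNbhd G u, corrMetric G u x ≤ fracCost G u := by
  calc ∑ x ∈ posNbhd G u, corrMetric G u x ≤ ∑ x ∈ posNbhd G u, pairCost G u x := by
        refine Finset.sum_le_sum fun x hx => ?_
        rcases mem_posNbhd.1 hx with rfl | h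
        · rw [corrMetric_self]; exact pairCost_nonneg G _ _
        · rw [pairCost_of_adj h]; exact corrMetric_le_adjCorrMetric G u x
    _ ≤ fracCost G u := Finset.sum_le_sum_of_subset_of_nonneg (Finset.subset_univ _)
        fun v _ _ => pairCost_nonneg G u v

lemma mul_card_posNbhd_le {G : SimpleGraph V} {u v : V} {c : ℚ} (hc : 0 ≤ c)
    (h : corrMetric G u v ≤ 1 - c) :
    c * (posNbhd G u).card ≤ ((posNbhd G u ∩ posNbhd G v).card : ℚ) := by
  rw [← one_sub_corrMetric_mul_card]
  exact mul_le_mul (by linarith) (card_posNbhd_le_union G u v) (Nat.cast_nonneg _) (by linarith)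

/-- Around a vertex `w` that is not isolated, there are few negative neighbors of `u`, compared to
the fractional cost of `u`. -/
lemma card_le_mul_fracCost {G : SimpleGraph V} {u w : V} (hw : ¬ IsIsolated G w)
    (hwu : corrMetric G w u ≤ 2 / 5) (X : Finset V)
    (hX : ∀ v ∈ X, v ∉ posNbhd G u ∧ corrMetric G w v ≤ 2 / 5) :
    (X.card : ℚ) ≤ 42 * fracCost G u := by
  have ha := card_posNbhd_pos G u
  set a : ℚ := ((posNbhd G u).card : ℚ) with ha_def
  -- 65/9 = (1 + 10/3) · 5/3: the first factor because w is not isolated, the second because w is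
  -- within 2/5 of u.
  have hXa : (X.card : ℚ) ≤ 65 / 9 * a := by
    have h1 : 3 / 5 * ((posNbhd G w).card : ℚ) ≤ a :=
      (mul_card_posNbhd_le (by norm_num) (by linarith)).trans
        (Nat.cast_le.2 (Finset.card_le_card Finset.inter_subset_right))
    have h2 : X ⊆ posNbhd G w ∪ (negNbhd G w).filter fun v => corrMetric G w v ≤ 7 / 10 := by
      intro v hv
      by_cases hvw : v ∈ posNbhd G w
      · exact Finset.mem_union_left _ hvw
      · exact Finset.mem_union_right _ (Finset.mem_filter.2
          ⟨mem_negNbhd_iff_notMem.2 hvw, by linarith [(hX v hv).2]⟩)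
    have h3 : (X.card : ℚ) ≤ (posNbhd G w).card +
        ((negNbhd G w).filter fun v => corrMetric G w v ≤ 7 / 10).card := by
      exact_mod_cast (Finset.card_le_card h2).trans (Finset.card_union_le _ _)
    rw [IsIsolated, not_le] at hw
    linarith
  have hcount : ∑ x ∈ posNbhd G u, (X.filter fun v => x ∈ posNbhd G v).card =
      ∑ v ∈ X, (posNbhd G u ∩ posNbhd G v).card := by
    have := Finset.sum_card_bipartiteAbove_eq_sum_card_bipartiteBelow (s := posNbhd G u) (t := X)
      (fun x v => x ∈ posNbhd G v)
    simpa only [Finset.bipartiteBelow, Finset.bipartiteAbove, Finset.filter_mem_eq_inter] using this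
  -- Members of X are within 4/5 of u through w, hence share a/5 positive neighbors with u. The
  -- pairs (x, v) of such a neighbor and a member of X are now counted from the side of x.
  have hlow : (X.card : ℚ) * (1 / 5 * a) ≤ ∑ v ∈ X, ((posNbhd G u ∩ posNbhd G v).card : ℚ) := by
    rw [← nsmul_eq_mul, ← Finset.sum_const]
    refine Finset.sum_le_sum fun v hv => mul_card_posNbhd_le (by norm_num) ?_
    have := corrMetric_triangle G u w v
    rw [corrMetric_comm G u w] at this
    linarith [(hX v hv).2]
  -- The m neighbors of x in X lie outside the neighborhood of u, so they push x away from u: m ≤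
  -- d(u, x) (a + m), and a + m ≤ (1 + 65/9) a.
  have hup : ∀ x ∈ posNbhd G u, ((X.filter fun v => x ∈ posNbhd G v).card : ℚ) ≤
      74 / 9 * a * corrMetric G u x := by
    intro x _
    set m : ℚ := ((X.filter fun v => x ∈ posNbhd G v).card : ℚ) with hm
    have hm1 : m ≤ X.card := Nat.cast_le.2 (Finset.card_le_card (Finset.filter_subset _ _))
    have hm2 : a + m ≤ ((posNbhd G u ∪ posNbhd G x).card : ℚ) := by
      rw [ha_def, hm, ← Nat.cast_add, ← Finset.card_union_of_disjoint]
      · refine Nat.cast_le.2 (Finset.card_le_card (Finset.union_subset_union_right fun v hv => ?_))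
        exact mem_posNbhd_comm.1 (Finset.mem_filter.1 hv).2
      · refine Finset.disjoint_left.2 fun v hv hv' => ?_
        exact (hX v (Finset.mem_filter.1 hv').1).1 hv
    have h1 := one_sub_corrMetric_mul_card G u x
    have h2 : ((posNbhd G u ∩ posNbhd G x).card : ℚ) ≤ a :=
      Nat.cast_le.2 (Finset.card_le_card Finset.inter_subset_left)
    have h3 := mul_le_mul_of_nonneg_left hm2 (sub_nonneg.2 (corrMetric_le_one G u x))
    have h4 : corrMetric G u x * (a + m) ≤ corrMetric G u x * (74 / 9 * a) :=
      mul_le_mul_of_nonneg_left (by linarith) (corrMetric_nonneg G u x)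
    linarith
  have hsum : ∑ v ∈ X, ((posNbhd G u ∩ posNbhd G v).card : ℚ) ≤ 74 / 9 * a * fracCost G u := by
    have : ∑ v ∈ X, ((posNbhd G u ∩ posNbhd G v).card : ℚ) =
        ∑ x ∈ posNbhd G u, ((X.filter fun v => x ∈ posNbhd G v).card : ℚ) := by
      exact_mod_cast hcount.symm
    rw [this]
    refine (Finset.sum_le_sum hup).trans ?_
    rw [← Finset.mul_sum]
    exact mul_le_mul_of_nonneg_left (sum_corrMetric_le_fracCost G u) (by positivity)
  have hfin : a * X.card ≤ a * (370 / 9 * fracCost G u) := by linarith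
  have := le_of_mul_le_mul_left hfin ha
  linarith [fracCost_nonneg G u]

/-- The contribution of `v` to the centrality of `u`. -/
noncomputable def proximity (G : SimpleGraph V) (u v : V) : ℚ := max 0 (1 / 5 - adjCorrMetric G u v)

lemma proximity_nonneg (G : SimpleGraph V) (u v : V) : 0 ≤ proximity G u v := le_max_left _ _

lemma le_proximity (G : SimpleGraph V) (u v : V) : 1 / 5 - adjCorrMetric G u v ≤ proximity G u v :=
  le_max_right _ _

lemma centrality_eq_sum (G : SimpleGraph V) (S : Finset V) (u : V) :
    centrality (adjCorrMetric G) (1 / 5) S u = ∑ v ∈ S, proximity G u v := by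
  rw [centrality, ballIn, Finset.sum_filter]
  refine Finset.sum_congr rfl fun v _ => ?_
  unfold proximity
  split_ifs with h
  · rw [max_eq_right (by linarith)]
  · rw [max_eq_left (by linarith)]

lemma mem_cluster {G : SimpleGraph V} {S : Finset V} {w v : V} :
    v ∈ ballIn (adjCorrMetric G) S w (2 * (1 / 5)) ↔ v ∈ S ∧ adjCorrMetric G w v ≤ 2 / 5 := by
  rw [ballIn, Finset.mem_filter]; norm_num

lemma eq_of_isIsolated_of_le {G : SimpleGraph V} {w v : V} (h : IsIsolated G w ∨ IsIsolated G v)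
    (hv : adjCorrMetric G w v ≤ 2 / 5) : w = v := by
  by_contra e
  rw [adjCorrMetric_eq_one_of_isIsolated e h] at hv
  norm_num at hv

/-- The positive edges between a new cluster and a vertex `u` that remains unclustered. -/
lemma sum_adj_cluster_le {G : SimpleGraph V} {S : Finset V} {w u : V}
    (hmax : centrality (adjCorrMetric G) (1 / 5) S u ≤ centrality (adjCorrMetric G) (1 / 5) S w)
    (huS : u ∈ S) (hu : u ∉ ballIn (adjCorrMetric G) S w (2 * (1 / 5))) :
    ∑ v ∈ ballIn (adjCorrMetric G) S w (2 * (1 / 5)), (if G.Adj u v then (1 : ℚ) else 0) ≤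
      10 * ∑ v ∈ ballIn (adjCorrMetric G) S w (2 * (1 / 5)), pairCost G u v := by
  set B := ballIn (adjCorrMetric G) S w (2 * (1 / 5)) with hB
  have hfu : 2 / 5 < adjCorrMetric G w u := by
    rw [mem_cluster] at hu
    by_contra h
    exact hu ⟨huS, not_lt.1 h⟩
  have termwise : (∀ v ∈ B, G.Adj u v → 1 / 10 ≤ adjCorrMetric G u v) →
      ∑ v ∈ B, (if G.Adj u v then (1 : ℚ) else 0) ≤ 10 * ∑ v ∈ B, pairCost G u v := by
    intro h
    rw [Finset.mul_sum]
    refine Finset.sum_le_sum fun v hv => ?_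
    have := pairCost_nonneg G u v
    split_ifs with hadj
    · have := h v hv hadj
      rw [pairCost_of_adj hadj]
      linarith
    · linarith
  -- If u or the center w is isolated, every positive edge in question has fractional cost 1; in the
  -- latter case the cluster is just {w}.
  by_cases hui : IsIsolated G u
  · refine termwise fun v _ hadj => ?_
    rw [adjCorrMetric_eq_one_of_isIsolated hadj.ne (Or.inl hui)]; norm_num
  by_cases hwi : IsIsolated G w
  · refine termwise fun v hv hadj => ?_
    have := eq_of_isIsolated_of_le (Or.inl hwi) (mem_cluster.1 hv).2
    subst this
    rw [adjCorrMetric_eq_one_of_isIsolated hadj.ne (Or.inr hwi)]; norm_num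
  have hdu : 2 / 5 < corrMetric G w u := by
    by_contra h
    rw [adjCorrMetric_eq_corrMetric hwi hui (Or.inr (by linarith))] at hfu
    exact h hfu
  have hBv : ∀ v ∈ B, ¬ IsIsolated G v ∧ adjCorrMetric G w v = corrMetric G w v ∧
      corrMetric G w v ≤ 2 / 5 := fun v hv => by
    have h := (mem_cluster.1 hv).2
    have h' := of_adjCorrMetric_lt_one hwi (h.trans_lt (by norm_num))
    exact ⟨h'.1, h'.2, h'.2 ▸ h⟩
  have htri : ∀ v, corrMetric G w u ≤ corrMetric G w v + corrMetric G u v := fun v => by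
    rw [corrMetric_comm G u v]; exact corrMetric_triangle G w v u
  -- Beyond 1/2, all v in the cluster are at distance more than 1/10 from u. Up to 1/2, every v
  -- within 1/5 of w is within 7/10 of u, so a negative pair (u, v) has not been rounded up.
  by_cases hfar : 1 / 2 < corrMetric G w u
  · refine termwise fun v hv _ => (?_ : _ ≤ _).trans (corrMetric_le_adjCorrMetric G u v)
    linarith [htri v, (hBv v hv).2.2]
  have key : ∀ v ∈ B, 1 / 5 * (if G.Adj u v then (1 : ℚ) else 0) - pairCost G u v ≤
      proximity G u v - proximity G w v := by
    intro v hv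
    obtain ⟨hvi, hwv, -⟩ := hBv v hv
    have h1 := htri v
    have h2 : corrMetric G u v ≤ corrMetric G w u + corrMetric G w v := by
      rw [corrMetric_comm G w u]; exact corrMetric_triangle G u w v
    have h3 := le_proximity G u v
    have h4 := proximity_nonneg G u v
    have h5 := corrMetric_le_adjCorrMetric G u v
    have huv : u ≠ v := fun e => hu (e ▸ hv)
    by_cases hadj : G.Adj u v
    · rw [if_pos hadj, pairCost_of_adj hadj]
      by_cases hr : corrMetric G w v ≤ 1 / 5
      · have : proximity G w v = 1 / 5 - corrMetric G w v := by
          rw [proximity, hwv, max_eq_right (by linarith)]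
        linarith
      · have : proximity G w v = 0 := by
          rw [proximity, hwv, max_eq_left (by linarith)]
        linarith
    · rw [if_neg hadj]
      by_cases hr : corrMetric G w v ≤ 1 / 5
      · have : proximity G w v = 1 / 5 - corrMetric G w v := by
          rw [proximity, hwv, max_eq_right (by linarith)]
        rw [pairCost_of_not_adj huv hadj,
          adjCorrMetric_eq_corrMetric hui hvi (Or.inr (by linarith))]
        linarith
      · have : proximity G w v = 0 := by
          rw [proximity, hwv, max_eq_left (by linarith)]
        linarith [pairCost_nonneg G u v]
  have hsum := Finset.sum_le_sum key
  rw [Finset.sum_sub_distrib, Finset.sum_sub_distrib, ← Finset.mul_sum] at hsum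
  rw [centrality_eq_sum, centrality_eq_sum] at hmax
  have hBS : B ⊆ S := Finset.filter_subset _ _
  have h1 : ∑ v ∈ B, proximity G u v ≤ ∑ v ∈ S, proximity G u v :=
    Finset.sum_le_sum_of_subset_of_nonneg hBS fun v _ _ => proximity_nonneg G u v
  -- The whole centrality of w comes from B, so maximality of w makes the right-hand side of the
  -- summed inequality at most 0.
  have h2 : ∑ v ∈ B, proximity G w v = ∑ v ∈ S, proximity G w v := by
    refine Finset.sum_subset hBS fun v hv hvB => ?_
    have : 2 / 5 < adjCorrMetric G w v := by
      by_contra h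
      exact hvB (mem_cluster.2 ⟨hv, not_lt.1 h⟩)
    rw [proximity, max_eq_left (by linarith)]
  have h3 : 0 ≤ ∑ v ∈ B, pairCost G u v := Finset.sum_nonneg fun v _ => pairCost_nonneg G u v
  linarith

/-- `1` if the pair `u`, `v` is a disagreement for the relation `R`, and `0` otherwise. -/
noncomputable def disagreement (G : SimpleGraph V) (R : V → V → Prop) (u v : V) : ℚ :=
  if u ≠ v ∧ ((G.Adj u v ∧ ¬ R u v) ∨ (¬ G.Adj u v ∧ R u v)) then 1 else 0

lemma cast_disagreements (G : SimpleGraph V) (C : Setoid V) (u : V) :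
    (disagreements G C u : ℚ) = ∑ v, disagreement G (fun x y => C x y) u v := by
  simp only [disagreement, Finset.sum_boole, disagreements]

lemma disagreement_congr {G : SimpleGraph V} {R R' : V → V → Prop} {u v : V}
    (h : R u v ↔ R' u v) : disagreement G R u v = disagreement G R' u v := by
  simp only [disagreement, h]

/-- The disagreements of a vertex `u` of a new cluster. -/
lemma sum_disagreement_cluster_le {G : SimpleGraph V} {S : Finset V} {w u : V}
    (hmax : centrality (adjCorrMetric G) (1 / 5) S u ≤ centrality (adjCorrMetric G) (1 / 5) S w)
    (hu : u ∈ ballIn (adjCorrMetric G) S w (2 * (1 / 5))) :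
    ∑ v ∈ S, disagreement G (fun _ y => y ∈ ballIn (adjCorrMetric G) S w (2 * (1 / 5))) u v ≤
      10 * ∑ v ∈ S, pairCost G u v + 42 * fracCost G u := by
  set B := ballIn (adjCorrMetric G) S w (2 * (1 / 5)) with hB
  obtain ⟨huS, hfu⟩ := mem_cluster.1 hu
  have hP : 0 ≤ ∑ v ∈ S, pairCost G u v := Finset.sum_nonneg fun v _ => pairCost_nonneg G u v
  have hF := fracCost_nonneg G u
  have termwise : (∀ v ∈ S, disagreement G (fun _ y => y ∈ B) u v ≤ 10 * pairCost G u v) →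
      ∑ v ∈ S, disagreement G (fun _ y => y ∈ B) u v ≤
        10 * ∑ v ∈ S, pairCost G u v + 42 * fracCost G u := by
    intro h
    have := Finset.sum_le_sum h
    rw [← Finset.mul_sum] at this
    linarith
  by_cases hiso : IsIsolated G w ∨ IsIsolated G u
  · have hwu := eq_of_isIsolated_of_le hiso hfu
    subst hwu
    rw [or_self] at hiso
    refine termwise fun v hv => ?_
    have h0 := pairCost_nonneg G w v
    unfold disagreement
    split_ifs with h
    · have hadj : G.Adj w v := by
        rcases h.2 with h' | h'
        · exact h'.1
        · exact absurd (eq_of_isIsolated_of_le (Or.inl hiso) (mem_cluster.1 h'.2).2) h.1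
      rw [pairCost_of_adj hadj, adjCorrMetric_eq_one_of_isIsolated h.1 (Or.inl hiso)]
      norm_num
    · linarith
  obtain ⟨hwi, hui⟩ := not_or.1 hiso
  have hdu : corrMetric G w u ≤ 2 / 5 := (corrMetric_le_adjCorrMetric G w u).trans hfu
  have hBv : ∀ v ∈ B, ¬ IsIsolated G v ∧ adjCorrMetric G w v = corrMetric G w v ∧
      corrMetric G w v ≤ 2 / 5 := fun v hv => by
    have h := (mem_cluster.1 hv).2
    have h' := of_adjCorrMetric_lt_one hwi (h.trans_lt (by norm_num))
    exact ⟨h'.1, h'.2, h'.2 ▸ h⟩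
  have hnB : ∀ v ∈ S, v ∉ B → 2 / 5 < adjCorrMetric G w v := fun v hv hvB => by
    by_contra h
    exact hvB (mem_cluster.2 ⟨hv, not_lt.1 h⟩)
  have htri1 : ∀ v, corrMetric G w v ≤ corrMetric G w u + corrMetric G u v := fun v =>
    corrMetric_triangle G w u v
  have htri2 : ∀ v, corrMetric G u v ≤ corrMetric G w u + corrMetric G w v := fun v => by
    rw [corrMetric_comm G w u]; exact corrMetric_triangle G u w v
  have htri3 : ∀ v, corrMetric G w u ≤ corrMetric G w v + corrMetric G u v := fun v => by
    rw [corrMetric_comm G u v]; exact corrMetric_triangle G w v u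
  -- Near the center every disagreement pays for itself: a positive neighbor outside the cluster is
  -- more than 1/5 away from u, a negative one inside at most 3/5.
  by_cases hnear : corrMetric G w u ≤ 1 / 5
  · refine termwise fun v hv => ?_
    have h0 := pairCost_nonneg G u v
    unfold disagreement
    split_ifs with h
    · obtain ⟨huv, ⟨hadj, hvB⟩ | ⟨hadj, hvB⟩⟩ := h
      · rw [pairCost_of_adj hadj]
        by_cases hvi : IsIsolated G v
        · rw [adjCorrMetric_eq_one_of_isIsolated huv (Or.inr hvi)]; norm_num
        · have h1 : 2 / 5 < corrMetric G w v := by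
            by_contra h
            have := hnB v hv hvB
            rw [adjCorrMetric_eq_corrMetric hwi hvi (Or.inr (by linarith))] at this
            exact h this
          linarith [htri1 v, corrMetric_le_adjCorrMetric G u v]
      · obtain ⟨hvi, -, hd⟩ := hBv v hvB
        have := htri2 v
        rw [pairCost_of_not_adj huv hadj,
          adjCorrMetric_eq_corrMetric hui hvi (Or.inr (by linarith))]
        linarith
    · linarith
  -- These negative pairs have fractional cost 0. They are paid for by the whole fractional cost of
  -- u, through the extra term in the comparison below.
  set X := B.filter fun v => v ∉ posNbhd G u ∧ 7 / 10 < corrMetric G u v with hX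
  have hXcard : (X.card : ℚ) ≤ 42 * fracCost G u :=
    card_le_mul_fracCost hwi hdu X fun v hv =>
      ⟨(Finset.mem_filter.1 hv).2.1, (hBv v (Finset.mem_filter.1 hv).1).2.2⟩
  have key : ∀ v ∈ S, 1 / 5 * disagreement G (fun _ y => y ∈ B) u v - pairCost G u v ≤
      proximity G u v - proximity G w v + 1 / 5 * (if v ∈ X then 1 else 0) := by
    intro v hv
    have h3 := le_proximity G u v
    have h4 := proximity_nonneg G u v
    have h5 := corrMetric_le_adjCorrMetric G u v
    have h6 := pairCost_nonneg G u v
    have h7 : (0 : ℚ) ≤ if v ∈ X then 1 else 0 := by split_ifs <;> norm_num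
    have t1 := htri1 v
    have t2 := htri2 v
    have t3 := htri3 v
    have hprox : proximity G w v ≤ 1 / 5 :=
      max_le (by norm_num) (by linarith [adjCorrMetric_nonneg G w v])
    -- The term at u itself is harmless: u has proximity 1/5 to itself, the largest value possible.
    by_cases huv : u = v
    · subst huv
      have : disagreement G (fun _ y => y ∈ B) u u = 0 := by simp [disagreement]
      rw [adjCorrMetric_self] at h3
      rw [this]
      linarith
    by_cases hvB : v ∈ B
    · obtain ⟨hvi, hwv, hd⟩ := hBv v hvB
      have hpw : corrMetric G w v ≤ 1 / 5 ∧ proximity G w v = 1 / 5 - corrMetric G w v ∨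
          1 / 5 ≤ corrMetric G w v ∧ proximity G w v = 0 := by
        rcases le_total (corrMetric G w v) (1 / 5) with h | h
        · exact Or.inl ⟨h, by rw [proximity, hwv, max_eq_right (by linarith)]⟩
        · exact Or.inr ⟨h, by rw [proximity, hwv, max_eq_left (by linarith)]⟩
      by_cases hadj : G.Adj u v
      · have : disagreement G (fun _ y => y ∈ B) u v = 0 := by simp [disagreement, hadj, hvB]
        rw [this]
        rw [pairCost_of_adj hadj] at h6 ⊢
        rcases hpw with ⟨_, h⟩ | ⟨_, h⟩ <;> linarith
      · have : disagreement G (fun _ y => y ∈ B) u v = 1 := by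
          simp [disagreement, hadj, hvB, huv]
        rw [this]
        by_cases hfar : 7 / 10 < corrMetric G u v
        -- Such v is more than 3/10 away from w, so it does not contribute to the centrality of w.
        · have hvX : v ∈ X := Finset.mem_filter.2 ⟨hvB, fun h => by
            rcases mem_posNbhd.1 h with h | h
            · exact huv h.symm
            · exact hadj h, hfar⟩
          rw [if_pos hvX]
          rcases hpw with ⟨_, h⟩ | ⟨_, h⟩ <;> linarith
        · rw [pairCost_of_not_adj huv hadj,
            adjCorrMetric_eq_corrMetric hui hvi (Or.inr (not_lt.1 hfar))]
          rcases hpw with ⟨_, h⟩ | ⟨_, h⟩ <;> linarith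
    · have hp0 : proximity G w v = 0 := by
        rw [proximity, max_eq_left (by linarith [hnB v hv hvB])]
      by_cases hadj : G.Adj u v
      · have : disagreement G (fun _ y => y ∈ B) u v = 1 := by
          simp [disagreement, hadj, hvB, huv]
        rw [this, pairCost_of_adj hadj]
        linarith
      · have : disagreement G (fun _ y => y ∈ B) u v = 0 := by simp [disagreement, hadj, hvB]
        rw [this]
        linarith
  have hsum := Finset.sum_le_sum key
  rw [Finset.sum_sub_distrib, Finset.sum_add_distrib, Finset.sum_sub_distrib, ← Finset.mul_sum,
    ← Finset.mul_sum, Finset.sum_boole] at hsum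
  rw [centrality_eq_sum, centrality_eq_sum] at hmax
  have hle : ((S.filter fun v => v ∈ X).card : ℚ) ≤ X.card :=
    Nat.cast_le.2 (Finset.card_le_card fun v hv => (Finset.mem_filter.1 hv).2)
  linarith

lemma RoundingRun.subset {z : V → V → ℚ} {r : ℚ} {S : Finset V} {Cs : List (Finset V)}
    (h : RoundingRun z r S Cs) : ∀ A ∈ Cs, A ⊆ S := by
  induction h with
  | done => simp
  | step S u Cs hu hmax hrest ih =>
    intro A hA
    rcases List.mem_cons.1 hA with rfl | hA
    · exact Finset.filter_subset _ _
    · exact (ih A hA).trans Finset.sdiff_subset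

/-- The relation of belonging to the same member of a list of clusters. -/
def SameCluster (Cs : List (Finset V)) (u v : V) : Prop := ∃ A ∈ Cs, u ∈ A ∧ v ∈ A

/-- While u is unclustered, each round pays only for the edges from u to the removed cluster. The
term 42 F u is spent once, in the round that clusters u, which also settles all edges from u to the
remaining vertices. -/
lemma RoundingRun.sum_disagreement_le {G : SimpleGraph V} {S : Finset V} {Cs : List (Finset V)}
    (h : RoundingRun (adjCorrMetric G) (1 / 5) S Cs) : ∀ u ∈ S,
    ∑ v ∈ S, disagreement G (SameCluster Cs) u v ≤
      10 * ∑ v ∈ S, pairCost G u v + 42 * fracCost G u := by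
  induction h with
  | done => simp
  | step S w Cs hw hmax hrest ih =>
    intro u hu
    set B := ballIn (adjCorrMetric G) S w (2 * (1 / 5)) with hB
    have hBS : B ⊆ S := Finset.filter_subset _ _
    by_cases huB : u ∈ B
    · refine le_trans (le_of_eq (Finset.sum_congr rfl fun v _ => disagreement_congr ?_))
        (sum_disagreement_cluster_le (hmax u hu) huB)
      refine ⟨?_, fun hv => ⟨B, List.mem_cons_self, huB, hv⟩⟩
      rintro ⟨A, hA, huA, hvA⟩
      rcases List.mem_cons.1 hA with rfl | hA
      · exact hvA
      · exact absurd huB (Finset.mem_sdiff.1 (hrest.subset A hA huA)).2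
    · have h1 := sum_adj_cluster_le (hmax u hu) hu huB
      rw [← hB] at h1
      have h2 := ih u (Finset.mem_sdiff.2 ⟨hu, huB⟩)
      have h3 : ∑ v ∈ S \ B, disagreement G (SameCluster (B :: Cs)) u v =
          ∑ v ∈ S \ B, disagreement G (SameCluster Cs) u v :=
        Finset.sum_congr rfl fun v _ => disagreement_congr (by simp [SameCluster, huB])
      have h4 : ∑ v ∈ B, disagreement G (SameCluster (B :: Cs)) u v =
          ∑ v ∈ B, (if G.Adj u v then (1 : ℚ) else 0) := by
        refine Finset.sum_congr rfl fun v hv => ?_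
        have hR : ¬ SameCluster (B :: Cs) u v := by
          rintro ⟨A, hA, huA, hvA⟩
          rcases List.mem_cons.1 hA with rfl | hA
          · exact huB huA
          · exact (Finset.mem_sdiff.1 (hrest.subset A hA hvA)).2 hv
        have huv : u ≠ v := fun e => huB (e ▸ hv)
        simp [disagreement, hR, huv]
      rw [← Finset.sum_sdiff hBS, ← Finset.sum_sdiff hBS, h3, h4]
      linarith

lemma disagreements_le_of_isRoundingOutput {G : SimpleGraph V} {C : Setoid V}
    (h : IsRoundingOutput (adjCorrMetric G) C) (u : V) :
    (disagreements G C u : ℚ) ≤ 52 * fracCost G u := by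
  obtain ⟨Cs, hrun, hC⟩ := h
  have h1 := hrun.sum_disagreement_le u (Finset.mem_univ u)
  rw [cast_disagreements]
  have h2 : ∑ v, disagreement G (fun x y => C x y) u v =
      ∑ v, disagreement G (SameCluster Cs) u v :=
    Finset.sum_congr rfl fun v _ => disagreement_congr (hC u v)
  rw [h2]
  have h3 : ∑ v, pairCost G u v = fracCost G u := rfl
  linarith

/-- The rounding algorithm approximates all `ℓ_p`-norms simultaneously. -/
lemma cost_le_of_isRoundingOutput {G : SimpleGraph V} {C : Setoid V}
    (h : IsRoundingOutput (adjCorrMetric G) C) {p : ENNReal} (hp : 1 ≤ p) :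
    cost G p C ≤ 6348 * opt G p := by
  have h1 : cost G p C ≤ 52 * vecNorm p (fun u => (fracCost G u : ℝ)) := by
    rw [← vecNorm_smul hp (by norm_num)]
    refine vecNorm_mono hp (fun u => Nat.cast_nonneg _) fun u => ?_
    exact_mod_cast disagreements_le_of_isRoundingOutput h u
  -- The factors give 52 · 60 = 3120; nonnegativity of the cost allows the weaker constant.
  have h2 : ∀ C' : Setoid V, cost G p C / 6348 ≤ cost G p C' := by
    intro C'
    have h3 := vecNorm_fracCost_le hp G C'
    have h4 : 0 ≤ cost G p C := by
      rw [cost]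
      have := vecNorm_mono (p := p) hp (f := fun _ : V => 0)
        (g := fun u => (disagreements G C u : ℝ)) (fun _ => le_rfl) fun _ => Nat.cast_nonneg _
      have h0 := vecNorm_smul (p := p) hp (c := 0) le_rfl (fun u => (disagreements G C u : ℝ))
      simp only [zero_mul] at h0
      rw [h0] at this
      exact this
    linarith
  have h5 : cost G p C / 6348 ≤ opt G p := le_ciInf h2
  linarith

end RoundingAnalysis

end CorrelationClustering

namespace RatRAM

/-! ### Locality of programs and a Hoare logic with step bounds -/

section Logic

@[simp] lemma State.setReg_reg (s : State) (x y : ℕ) (q : ℚ) :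
    (s.setReg x q).reg y = if y = x then q else s.reg y := by
  simp [State.setReg, Function.update_apply]

@[simp] lemma State.setReg_arr (s : State) (x : ℕ) (q : ℚ) : (s.setReg x q).arr = s.arr := rfl

@[simp] lemma State.setCell_reg (s : State) (a k : ℕ) (q : ℚ) : (s.setCell a k q).reg = s.reg := rfl

@[simp] lemma State.setCell_arr (s : State) (a k b l : ℕ) (q : ℚ) :
    (s.setCell a k q).arr b l = if b = a ∧ l = k then q else s.arr b l := by
  simp only [State.setCell, Function.update_apply]
  split_ifs <;> simp_all

lemma State.setCell_arr_of_ne (s : State) {a b : ℕ} (k : ℕ) (q : ℚ) (h : b ≠ a) :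
    (s.setCell a k q).arr b = s.arr b := by
  simp [State.setCell, h]

@[simp] lemma index_natCast (k : ℕ) : index (k : ℚ) = some k := by
  simp [index]

/-- A number that exceeds all registers and arrays occurring in an expression. -/
def Expr.bound : Expr → ℕ
  | .const _ => 0
  | .reg x => x + 1
  | .cell a i => max (a + 1) i.bound
  | .op _ e₁ e₂ => max e₁.bound e₂.bound

/-- A number that exceeds all registers and arrays occurring in a program. -/
def Prog.bound : Prog → ℕ
  | .skip => 0
  | .assign x e => max (x + 1) e.bound
  | .store a i e => max (a + 1) (max i.bound e.bound)
  | .seq P Q => max P.bound Q.bound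
  | .ite e P Q => max e.bound (max P.bound Q.bound)
  | .while e P => max e.bound P.bound

/-- Two states agree on the registers and arrays below `m`. -/
def Agree (m : ℕ) (s s' : State) : Prop :=
  (∀ x < m, s'.reg x = s.reg x) ∧ ∀ a < m, s'.arr a = s.arr a

/-- Two states agree on the registers and arrays from `m` on. -/
def AgreeAbove (m : ℕ) (s s' : State) : Prop :=
  (∀ x, m ≤ x → s'.reg x = s.reg x) ∧ ∀ a, m ≤ a → s'.arr a = s.arr a

lemma Expr.eval_eq_of_agree {m : ℕ} {s s' : State} (h : Agree m s s') :
    ∀ {e : Expr}, e.bound ≤ m → e.eval s' = e.eval s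
  | .const _, _ => rfl
  | .reg x, hb => by
    have : x < m := hb
    simp [Expr.eval, h.1 x this]
  | .cell a i, hb => by
    simp only [Expr.bound, max_le_iff] at hb
    simp [Expr.eval, Expr.eval_eq_of_agree h hb.2, h.2 a hb.1]
  | .op _ e₁ e₂, hb => by
    simp only [Expr.bound, max_le_iff] at hb
    simp [Expr.eval, Expr.eval_eq_of_agree h hb.1, Expr.eval_eq_of_agree h hb.2]

/-- A program behaves in the same way in states that differ only beyond its registers and arrays. -/
lemma Runs.transfer {P : Prog} {s s' : State} {t m : ℕ} (h : Runs P s t s') :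
    P.bound ≤ m → ∀ r, Agree m s r →
      ∃ r', Runs P r t r' ∧ Agree m s' r' ∧ AgreeAbove m r r' := by
  induction h with
  | skip s => exact fun _ r hr => ⟨r, .skip r, hr, fun _ _ => rfl, fun _ _ => rfl⟩
  | assign x e s q he =>
    intro hb r hr
    simp only [Prog.bound, max_le_iff] at hb
    refine ⟨_, .assign x e r q ((Expr.eval_eq_of_agree hr hb.2).trans he),
      ⟨fun y hy => ?_, hr.2⟩, fun y hy => ?_, fun _ _ => rfl⟩
    · simp [hr.1 y hy]
    · rw [State.setReg_reg, if_neg (by omega)]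
  | store a i e s j q k hi hk he =>
    intro hb r hr
    simp only [Prog.bound, max_le_iff] at hb
    refine ⟨_, .store a i e r j q k ((Expr.eval_eq_of_agree hr hb.2.1).trans hi) hk
      ((Expr.eval_eq_of_agree hr hb.2.2).trans he), ⟨hr.1, fun b hb' => ?_⟩, fun _ _ => rfl,
      fun b hb' => ?_⟩
    · funext l; simp [hr.2 b hb']
    · exact State.setCell_arr_of_ne _ _ _ (by omega)
  | seq P Q s s₁ s₂ t₁ t₂ hP hQ ihP ihQ =>
    intro hb r hr
    simp only [Prog.bound, max_le_iff] at hb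
    obtain ⟨r₁, h1, h2, h3⟩ := ihP hb.1 r hr
    obtain ⟨r₂, h4, h5, h6⟩ := ihQ hb.2 r₁ h2
    exact ⟨r₂, .seq P Q r r₁ r₂ t₁ t₂ h1 h4, h5, fun x hx => (h6.1 x hx).trans (h3.1 x hx),
      fun x hx => (h6.2 x hx).trans (h3.2 x hx)⟩
  | iteTrue e P Q s s' q t he hq hP ih =>
    intro hb r hr
    simp only [Prog.bound, max_le_iff] at hb
    obtain ⟨r₁, h1, h2, h3⟩ := ih hb.2.1 r hr
    exact ⟨r₁, .iteTrue e P Q r r₁ q t ((Expr.eval_eq_of_agree hr hb.1).trans he) hq h1, h2, h3⟩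
  | iteFalse e P Q s s' t he hQ ih =>
    intro hb r hr
    simp only [Prog.bound, max_le_iff] at hb
    obtain ⟨r₁, h1, h2, h3⟩ := ih hb.2.2 r hr
    exact ⟨r₁, .iteFalse e P Q r r₁ t ((Expr.eval_eq_of_agree hr hb.1).trans he) h1, h2, h3⟩
  | whileTrue e P s s₁ s₂ q t₁ t₂ he hq hP hrest ihP ihQ =>
    intro hb r hr
    have hb' := hb
    simp only [Prog.bound, max_le_iff] at hb
    obtain ⟨r₁, h1, h2, h3⟩ := ihP hb.2 r hr
    obtain ⟨r₂, h4, h5, h6⟩ := ihQ hb' r₁ h2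
    exact ⟨r₂, .whileTrue e P r r₁ r₂ q t₁ t₂ ((Expr.eval_eq_of_agree hr hb.1).trans he) hq h1 h4,
      h5, fun x hx => (h6.1 x hx).trans (h3.1 x hx), fun x hx => (h6.2 x hx).trans (h3.2 x hx)⟩
  | whileFalse e P s he =>
    intro hb r hr
    simp only [Prog.bound, max_le_iff] at hb
    exact ⟨r, .whileFalse e P r ((Expr.eval_eq_of_agree hr hb.1).trans he), hr,
      fun _ _ => rfl, fun _ _ => rfl⟩

/-- In `t` steps, at most `t` cells of an array change. -/
lemma Runs.exists_card_le {P : Prog} {s s' : State} {t : ℕ} (h : Runs P s t s') (a : ℕ) :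
    ∃ F : Finset ℕ, F.card ≤ t ∧ ∀ k ∉ F, s'.arr a k = s.arr a k := by
  induction h with
  | skip s => exact ⟨∅, by simp, fun _ _ => rfl⟩
  | assign x e s q he => exact ⟨∅, by simp, fun _ _ => rfl⟩
  | store b i e s j q k hi hk he =>
    refine ⟨{k}, by simp, fun l hl => ?_⟩
    rw [State.setCell_arr, if_neg]
    rintro ⟨_, rfl⟩
    simp at hl
  | seq P Q s s₁ s₂ t₁ t₂ hP hQ ihP ihQ =>
    obtain ⟨F₁, h1, h2⟩ := ihP
    obtain ⟨F₂, h3, h4⟩ := ihQ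
    refine ⟨F₁ ∪ F₂, (Finset.card_union_le _ _).trans (by omega), fun k hk => ?_⟩
    rw [Finset.mem_union, not_or] at hk
    rw [h4 k hk.2, h2 k hk.1]
  | iteTrue e P Q s s' q t he hq hP ih =>
    obtain ⟨F, h1, h2⟩ := ih
    exact ⟨F, by omega, h2⟩
  | iteFalse e P Q s s' t he hQ ih =>
    obtain ⟨F, h1, h2⟩ := ih
    exact ⟨F, by omega, h2⟩
  | whileTrue e P s s₁ s₂ q t₁ t₂ he hq hP hrest ihP ihQ =>
    obtain ⟨F₁, h1, h2⟩ := ihP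
    obtain ⟨F₂, h3, h4⟩ := ihQ
    refine ⟨F₁ ∪ F₂, (Finset.card_union_le _ _).trans (by omega), fun k hk => ?_⟩
    rw [Finset.mem_union, not_or] at hk
    rw [h4 k hk.2, h2 k hk.1]
  | whileFalse e P s he => exact ⟨∅, by simp, fun _ _ => rfl⟩

/-- Started in the state `s`, the program `P` halts after at most `b` steps in a state with the
property `Q`. -/
def Spec (P : Prog) (s : State) (b : ℕ) (Q : State → Prop) : Prop :=
  ∃ t s', Runs P s t s' ∧ t ≤ b ∧ Q s'

lemma Spec.mono {P : Prog} {s : State} {b b' : ℕ} {Q Q' : State → Prop} (h : Spec P s b Q)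
    (hb : b ≤ b') (hQ : ∀ s', Q s' → Q' s') : Spec P s b' Q' := by
  obtain ⟨t, s', h1, h2, h3⟩ := h
  exact ⟨t, s', h1, h2.trans hb, hQ s' h3⟩

lemma Spec.skip {s : State} {b : ℕ} {Q : State → Prop} (hQ : Q s) (hb : 1 ≤ b) :
    Spec .skip s b Q :=
  ⟨1, s, .skip s, hb, hQ⟩

lemma Spec.assign {x : ℕ} {e : Expr} {s : State} {q : ℚ} {b : ℕ} {Q : State → Prop}
    (he : e.eval s = some q) (hQ : Q (s.setReg x q)) (hb : e.steps + 1 ≤ b) :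
    Spec (.assign x e) s b Q :=
  ⟨_, _, .assign x e s q he, hb, hQ⟩

lemma Spec.store {a : ℕ} {i e : Expr} {s : State} {k : ℕ} {q : ℚ} {b : ℕ} {Q : State → Prop}
    (hi : i.eval s = some (k : ℚ)) (he : e.eval s = some q) (hQ : Q (s.setCell a k q))
    (hb : i.steps + e.steps + 1 ≤ b) : Spec (.store a i e) s b Q :=
  ⟨_, _, .store a i e s k q k hi (index_natCast k) he, hb, hQ⟩

lemma Spec.seq {P R : Prog} {s : State} {b₁ b₂ b : ℕ} {Q : State → Prop}
    (h : Spec P s b₁ fun s' => Spec R s' b₂ Q) (hb : b₁ + b₂ ≤ b) : Spec (.seq P R) s b Q := by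
  obtain ⟨t₁, s₁, h1, h2, t₂, s₂, h3, h4, h5⟩ := h
  exact ⟨_, _, .seq P R s s₁ s₂ t₁ t₂ h1 h3, by omega, h5⟩

lemma Spec.iteTrue {e : Expr} {P R : Prog} {s : State} {q : ℚ} {b b' : ℕ} {Q : State → Prop}
    (he : e.eval s = some q) (hq : q ≠ 0) (h : Spec P s b Q) (hb : e.steps + 1 + b ≤ b') :
    Spec (.ite e P R) s b' Q := by
  obtain ⟨t, s', h1, h2, h3⟩ := h
  exact ⟨_, _, .iteTrue e P R s s' q t he hq h1, by omega, h3⟩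

lemma Spec.iteFalse {e : Expr} {P R : Prog} {s : State} {b b' : ℕ} {Q : State → Prop}
    (he : e.eval s = some 0) (h : Spec R s b Q) (hb : e.steps + 1 + b ≤ b') :
    Spec (.ite e P R) s b' Q := by
  obtain ⟨t, s', h1, h2, h3⟩ := h
  exact ⟨_, _, .iteFalse e P R s s' t he h1, by omega, h3⟩

/-- The loop that executes `P` while the register `i` runs from `0` to the value of `e`. -/
def forLoop (i : ℕ) (e : Expr) (P : Prog) : Prog :=
  .seq (.assign i (.const 0))
    (.while (.op .lt (.reg i) e) (.seq P (.assign i (.op .add (.reg i) (.const 1)))))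

/-- The cost `c k` may vary with the iteration, which is what allows the amortized bound in
`spec_clusterProg`. The 9 covers the comparison and the increment; the extra round in N + 1 covers
the initialization and the failing last test. -/
lemma Spec.forLoop {i : ℕ} {e : Expr} {P : Prog} {s : State} {N b : ℕ} {Q : State → Prop}
    (c : ℕ → ℕ) (Inv : ℕ → State → Prop) (h0 : Inv 0 (s.setReg i 0))
    (hInv : ∀ k ≤ N, ∀ s, Inv k s → s.reg i = k ∧ e.eval s = some (N : ℚ))
    (hstep : ∀ k < N, ∀ s, Inv k s →
      Spec P s (c k) fun s' => s'.reg i = k ∧ Inv (k + 1) (s'.setReg i ((k + 1 : ℕ) : ℚ)))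
    (hQ : ∀ s, Inv N s → Q s)
    (hb : (∑ k ∈ Finset.range N, c k) + (N + 1) * (e.steps + 9) ≤ b) :
    Spec (forLoop i e P) s b Q := by
  have loop : ∀ d k, k + d = N → ∀ s, Inv k s →
      Spec (.while (.op .lt (.reg i) e) (.seq P (.assign i (.op .add (.reg i) (.const 1))))) s
        ((∑ l ∈ Finset.range d, c (k + l)) + d * (e.steps + 9) + (e.steps + 3)) Q := by
    intro d
    induction d with
    | zero =>
      intro k hk s hs
      obtain rfl : k = N := hk
      obtain ⟨h1, h2⟩ := hInv k le_rfl s hs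
      refine ⟨_, _, .whileFalse _ _ s ?_, ?_, hQ s hs⟩
      · simp [Expr.eval, h1, h2, Op.apply]
      · simp only [Expr.steps]; omega
    | succ d ih =>
      intro k hk s hs
      obtain ⟨h1, h2⟩ := hInv k (by omega) s hs
      obtain ⟨t, s₁, h3, h4, h5, h6⟩ := hstep k (by omega) s hs
      obtain ⟨t', s₂, h7, h8, h9⟩ := ih (k + 1) (by omega) _ h6
      have he : (Expr.op .lt (.reg i) e).eval s = some 1 := by
        have : (k : ℚ) < N := by exact_mod_cast (by omega : k < N)
        simp [Expr.eval, h1, h2, Op.apply, this]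
      have ha : Runs (.assign i (.op .add (.reg i) (.const 1))) s₁ 4
          (s₁.setReg i ((k + 1 : ℕ) : ℚ)) := by
        refine .assign i (.op .add (.reg i) (.const 1)) s₁ _ ?_
        simp [Expr.eval, h5, Op.apply]
      refine ⟨_, _, .whileTrue _ _ s _ s₂ 1 _ t' he one_ne_zero (.seq _ _ _ _ _ _ _ h3 ha) h7,
        ?_, h9⟩
      have e1 : ∑ l ∈ Finset.range (d + 1), c (k + l) =
          (∑ l ∈ Finset.range d, c (k + 1 + l)) + c k := by
        rw [Finset.sum_range_succ']
        simp only [add_zero]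
        congr 1
        refine Finset.sum_congr rfl fun l _ => ?_
        congr 1; omega
      rw [e1]
      simp only [Expr.steps, Nat.succ_mul] at *
      omega
  have := loop N 0 (by omega) _ h0
  simp only [zero_add] at this
  refine Spec.seq (b₁ := 2) (Spec.assign rfl this (by simp [Expr.steps])) ?_
  rw [Nat.succ_mul] at hb
  omega

/-- The loop that computes in the register `c` the sum of the values of `e`, while the register `i`
runs through the numbers below the value of the register `N`. -/
def sumLoop (i c N : ℕ) (e : Expr) : Prog :=
  .seq (.assign c (.const 0)) (forLoop i (.reg N) (.assign c (.op .add (.reg c) e)))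

lemma Spec.sumLoop {i c N : ℕ} {e : Expr} {s : State} {n b : ℕ} {Q : State → Prop}
    (g : Fin n → ℚ) (hic : i ≠ c) (hiN : i ≠ N) (hcN : c ≠ N) (hN : s.reg N = n)
    (he : ∀ (v : Fin n) (x : ℚ), e.eval ((s.setReg c x).setReg i (v : ℕ)) = some (g v))
    (hQ : Q ((s.setReg c (∑ v, g v)).setReg i n))
    (hb : (n + 1) * (e.steps + 15) ≤ b) : Spec (sumLoop i c N e) s b Q := by
  set g' : ℕ → ℚ := fun k => if h : k < n then g ⟨k, h⟩ else 0 with hg'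
  have hsum : ∑ k ∈ Finset.range n, g' k = ∑ v, g v := by
    rw [Finset.sum_range]
    simp [hg']
  have hval : ∀ k (hk : k < n), g' k = g ⟨k, hk⟩ := fun k hk => dif_pos hk
  clear_value g'
  refine Spec.seq (b₁ := 2) (b₂ := n * (e.steps + 3) + (n + 1) * 10)
    (Spec.assign rfl ?_ (by simp [Expr.steps])) ?_
  · refine Spec.forLoop (N := n) (fun _ => e.steps + 3)
      (fun k s' => s' = (s.setReg c (∑ l ∈ Finset.range k, g' l)).setReg i k) (by simp) ?_ ?_ ?_ ?_
    · rintro k _ _ rfl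
      simp [Expr.eval, hiN.symm, hcN.symm, hN]
    · rintro k hk _ rfl
      refine Spec.assign (q := (∑ l ∈ Finset.range k, g' l) + g' k) ?_ ⟨?_, ?_⟩
        (by simp only [Expr.steps]; omega)
      · have := he ⟨k, hk⟩ (∑ l ∈ Finset.range k, g' l)
        simp only at this
        simp [Expr.eval, this, Op.apply, hic.symm, hval k hk]
      · simp [hic]
      · rw [Finset.sum_range_succ]
        simp only [State.setReg, State.mk.injEq, and_true]
        funext y
        simp only [Function.update_apply]
        split_ifs <;> rfl
    · rintro _ rfl
      rw [hsum]; exact hQ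
    · simp [Expr.steps]
  · nlinarith

/-- The loop that stores in every cell `u` of the array `a` the value of `e'`, after the values of
`e` at `u` and all `v` have been summed up in the register `c`. -/
def rowLoop (i j c N a : ℕ) (e e' : Expr) : Prog :=
  forLoop i (.reg N) (.seq (sumLoop j c N e) (.store a (.reg i) e'))

/-- The expressions must have the right value in every state that differs from s only in the scratch
registers and in the target array, hence at any moment of the loop. -/
lemma Spec.rowLoop {i j c N a : ℕ} {e e' : Expr} {s : State} {n b : ℕ} {Q : State → Prop}
    (g : Fin n → Fin n → ℚ) (h : Fin n → ℚ) (hij : i ≠ j) (hic : i ≠ c) (hjc : j ≠ c) (hiN : i ≠ N)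
    (hjN : j ≠ N) (hcN : c ≠ N) (hN : s.reg N = n)
    (he : ∀ s' : State, (∀ x, x ≠ i → x ≠ j → x ≠ c → s'.reg x = s.reg x) →
      (∀ a', a' ≠ a → s'.arr a' = s.arr a') → ∀ u v : Fin n, s'.reg i = (u : ℕ) →
      s'.reg j = (v : ℕ) → e.eval s' = some (g u v))
    (he' : ∀ s' : State, (∀ x, x ≠ i → x ≠ j → x ≠ c → s'.reg x = s.reg x) →
      (∀ a', a' ≠ a → s'.arr a' = s.arr a') → ∀ u : Fin n, s'.reg i = (u : ℕ) →
      s'.reg c = ∑ v, g u v → e'.eval s' = some (h u))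
    (hQ : ∀ s' : State, (∀ x, x ≠ i → x ≠ j → x ≠ c → s'.reg x = s.reg x) →
      (∀ a', a' ≠ a → s'.arr a' = s.arr a') → (∀ u : Fin n, s'.arr a (u : ℕ) = h u) → Q s')
    (hb : (n + 1) * (n + 1) * (e.steps + e'.steps + 30) ≤ b) : Spec (rowLoop i j c N a e e') s b Q := by
  refine Spec.forLoop (N := n) (fun _ => (n + 1) * (e.steps + 15) + (e'.steps + 2))
    (fun k s' => s'.reg i = k ∧ (∀ x, x ≠ i → x ≠ j → x ≠ c → s'.reg x = s.reg x) ∧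
      (∀ a', a' ≠ a → s'.arr a' = s.arr a') ∧ ∀ u : Fin n, (u : ℕ) < k → s'.arr a (u : ℕ) = h u)
    ?_ ?_ ?_ ?_ ?_
  · refine ⟨by simp, fun x h1 _ _ => by simp [h1], fun _ _ => rfl, fun u hu => by omega⟩
  · rintro k _ s' ⟨h1, h2, -, -⟩
    refine ⟨h1, ?_⟩
    simp only [Expr.eval]
    rw [h2 N hiN.symm hjN.symm hcN.symm, hN]
  · rintro k hk s' ⟨h1, h2, h3, h4⟩
    refine Spec.seq (Spec.sumLoop (fun v => g ⟨k, hk⟩ v) hjc hjN hcN ?_ ?_ ?_ le_rfl) le_rfl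
    · rw [h2 N hiN.symm hjN.symm hcN.symm, hN]
    · intro v x
      refine he ((s'.setReg c x).setReg j (v : ℕ)) (fun y hy1 hy2 hy3 => ?_) h3 ⟨k, hk⟩ v ?_ ?_
      · simp [hy2, hy3, h2 y hy1 hy2 hy3]
      · simp [hij, hic, h1]
      · simp
    · refine Spec.store (k := k) (q := h ⟨k, hk⟩) ?_ ?_ ⟨?_, ?_, ?_, ?_, ?_⟩ ?_
      · simp [Expr.eval, hij, hic, h1]
      · refine he' ((s'.setReg c (∑ v, g ⟨k, hk⟩ v)).setReg j n) (fun y hy1 hy2 hy3 => ?_) h3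
          ⟨k, hk⟩ ?_ ?_
        · simp [hy2, hy3, h2 y hy1 hy2 hy3]
        · simp [hij, hic, h1]
        · simp [hjc.symm]
      · simp [hij, hic, h1]
      · simp
      · intro x hx1 hx2 hx3
        simp [hx1, hx2, hx3, h2 x hx1 hx2 hx3]
      · intro a' ha'
        rw [State.setReg_arr, State.setCell_arr_of_ne _ _ _ ha']
        exact h3 a' ha'
      · intro u hu
        rw [State.setReg_arr, State.setCell_arr]
        by_cases hu' : (u : ℕ) = k
        · rw [if_pos ⟨rfl, hu'⟩]
          congr 1
          exact Fin.ext hu'.symm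
        · rw [if_neg (by tauto)]
          exact h4 u (by omega)
      · simp only [Expr.steps]; omega
  · rintro s' ⟨-, h2, h3, h4⟩
    exact hQ s' h2 h3 fun u => h4 u u.2
  · simp only [Finset.sum_const, Finset.card_range, smul_eq_mul, Expr.steps]
    refine le_trans ?_ hb
    nlinarith [Nat.zero_le (n * e'.steps), Nat.zero_le (n * n * e'.steps), Nat.zero_le (n * e.steps),
      Nat.zero_le (n * n)]

end Logic

end RatRAM

namespace CorrelationClustering

/-! ### Arithmetic formulas for the metric in terms of common neighbor counts -/

section Formulas

open Classical

variable {V : Type*} [Fintype V]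

/-- The adjacency matrix of the positive edges with the positive self-loops. -/
noncomputable def posIndicator (G : SimpleGraph V) (u v : V) : ℚ :=
  if v ∈ posNbhd G u then 1 else 0

lemma posIndicator_eq (G : SimpleGraph V) (u v : V) :
    posIndicator G u v = if u = v then 1 else if G.Adj u v then 1 else 0 := by
  by_cases huv : u = v
  · simp [posIndicator, huv, self_mem_posNbhd]
  · have : v ∈ posNbhd G u ↔ G.Adj u v := by
      rw [mem_posNbhd]; exact or_iff_right (Ne.symm huv)
    simp only [posIndicator, huv, this, if_false]

/-- The number of common positive neighbors. -/
noncomputable def commonCount (G : SimpleGraph V) (u v : V) : ℚ :=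
  (posNbhd G u ∩ posNbhd G v).card

/-- The indicator function of the isolated vertices. -/
noncomputable def isoIndicator (G : SimpleGraph V) (u : V) : ℚ := if IsIsolated G u then 1 else 0

lemma commonCount_eq_sum (G : SimpleGraph V) (u v : V) :
    commonCount G u v = ∑ w, posIndicator G u w * posIndicator G w v := by
  have : ∀ w, posIndicator G u w * posIndicator G w v =
      if w ∈ posNbhd G u ∩ posNbhd G v then 1 else 0 := fun w => by
    simp only [posIndicator, mem_posNbhd_comm (u := w) (v := v), Finset.mem_inter]
    split_ifs <;> simp_all
  simp only [this, Finset.sum_boole, commonCount, Finset.filter_mem_eq_inter, Finset.univ_inter]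

lemma commonCount_self (G : SimpleGraph V) (u : V) :
    commonCount G u u = (posNbhd G u).card := by
  simp [commonCount]

lemma commonCount_union (G : SimpleGraph V) (u v : V) :
    commonCount G u u + commonCount G v v - commonCount G u v =
      ((posNbhd G u ∪ posNbhd G v).card : ℚ) := by
  have := Finset.card_union_add_card_inter (posNbhd G u) (posNbhd G v)
  have h : ((posNbhd G u ∪ posNbhd G v).card : ℚ) + commonCount G u v =
      (posNbhd G u).card + (posNbhd G v).card := by
    rw [commonCount]; exact_mod_cast this
  rw [commonCount_self, commonCount_self]
  linarith

/-- This is the divisor used by the machine, so its division cannot fail. -/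
lemma commonCount_union_ne_zero (G : SimpleGraph V) (u v : V) :
    commonCount G u u + commonCount G v v - commonCount G u v ≠ 0 := by
  rw [commonCount_union]; exact (card_union_posNbhd_pos G u v).ne'

lemma corrMetric_eq_commonCount (G : SimpleGraph V) (u v : V) :
    corrMetric G u v =
      1 - commonCount G u v / (commonCount G u u + commonCount G v v - commonCount G u v) := by
  rw [commonCount_union]; rfl

lemma isIsolated_iff (G : SimpleGraph V) (u : V) :
    IsIsolated G u ↔ 10 / 3 * commonCount G u u ≤
      ∑ v, (1 - posIndicator G u v) * (1 - if 7 / 10 < corrMetric G u v then 1 else 0) := by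
  have : ∀ v, (1 - posIndicator G u v) * (1 - if 7 / 10 < corrMetric G u v then 1 else 0) =
      if v ∈ negNbhd G u ∧ corrMetric G u v ≤ 7 / 10 then 1 else 0 := fun v => by
    simp only [posIndicator, mem_negNbhd_iff_notMem, ← not_lt]
    split_ifs <;> simp_all
  simp only [this, Finset.sum_boole, IsIsolated, commonCount_self, ← Finset.filter_filter,
    Finset.filter_mem_eq_inter, Finset.univ_inter]

lemma isoIndicator_eq (G : SimpleGraph V) (u : V) :
    isoIndicator G u = 1 - if (∑ v, (1 - posIndicator G u v) *
      (1 - if 7 / 10 < corrMetric G u v then 1 else 0)) < 10 / 3 * commonCount G u u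
      then 1 else 0 := by
  rw [isoIndicator, isIsolated_iff]
  split_ifs with h1 h2
  · exact absurd h1 (not_le.2 h2)
  · norm_num
  · norm_num
  · exact absurd (not_lt.1 ‹_›) h1

/-- Machine expressions have no conditionals, only comparisons with value 0 or 1, so the case
distinction becomes arithmetic: a disjunction is the positivity of a sum of indicators. -/
lemma adjCorrMetric_eq (G : SimpleGraph V) (u v : V) :
    adjCorrMetric G u v = (1 - if u = v then 1 else 0) *
      ((if 0 < isoIndicator G u + isoIndicator G v + (1 - posIndicator G u v) *
          (if 7 / 10 < corrMetric G u v then 1 else 0) then 1 else 0) +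
        (1 - if 0 < isoIndicator G u + isoIndicator G v + (1 - posIndicator G u v) *
          (if 7 / 10 < corrMetric G u v then 1 else 0) then 1 else 0) * corrMetric G u v) := by
  have hmem : u ≠ v → (v ∈ posNbhd G u ↔ G.Adj u v) := fun h => by
    rw [mem_posNbhd]; exact or_iff_right h.symm
  by_cases huv : u = v
  · subst huv; simp [adjCorrMetric_self]
  · simp only [adjCorrMetric, isoIndicator, posIndicator, hmem huv, if_neg huv]
    by_cases h1 : IsIsolated G u <;> by_cases h2 : IsIsolated G v <;> by_cases h3 : G.Adj u v <;>
      by_cases h4 : 7 / 10 < corrMetric G u v <;> norm_num [h1, h2, h3, h4]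

lemma proximity_eq (G : SimpleGraph V) (u v : V) :
    proximity G u v = (if adjCorrMetric G u v < 1 / 5 then 1 else 0) *
      (1 / 5 - adjCorrMetric G u v) := by
  unfold proximity
  split_ifs with h
  · rw [max_eq_right (by linarith), one_mul]
  · rw [max_eq_left (by linarith), zero_mul]

/-- The remainder is given by its membership condition, so that a filter can take the place of the
set difference. -/
lemma RoundingRun.step_of_mem_iff {z : V → V → ℚ} {r : ℚ} {S S' : Finset V} {u : V}
    {Cs : List (Finset V)} (hu : u ∈ S)
    (hmax : ∀ v ∈ S, centrality z r S v ≤ centrality z r S u)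
    (hS' : ∀ v, v ∈ S' ↔ v ∈ S ∧ ¬ z u v ≤ 2 * r) (h : RoundingRun z r S' Cs) :
    RoundingRun z r S (ballIn z S u (2 * r) :: Cs) := by
  refine .step S u Cs hu hmax ?_
  convert h
  ext v
  simp only [Finset.mem_sdiff, ballIn, Finset.mem_filter, hS']
  tauto

end Formulas

end CorrelationClustering

namespace RatRAM

open CorrelationClustering

/-! ### Machine expressions for the metric -/

section Expressions

variable {n : ℕ}

/-- The cell of the array `a` for the row in the register `x` and the column in the register `y`,
for matrices whose dimension is in the register `N`. -/
def matrixCell (a N x y : ℕ) : Expr := .cell a (.op .add (.op .mul (.reg x) (.reg N)) (.reg y))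

lemma eval_matrixCell {a N x y : ℕ} {s : State} {u v : ℕ} (hN : s.reg N = n) (hx : s.reg x = u)
    (hy : s.reg y = v) : (matrixCell a N x y).eval s = some (s.arr a (u * n + v)) := by
  have : (u : ℚ) * n + v = ((u * n + v : ℕ) : ℚ) := by push_cast; ring
  simp only [matrixCell, Expr.eval, hN, hx, hy, Op.apply, Option.bind_some, this, index_natCast,
    Option.map_some]

/-- The state holds `n` in the register `m`, the numbers of common neighbors in the array `2` and
the adjacency matrix in the array `m`. -/
structure HasGraph (m : ℕ) (G : SimpleGraph (Fin n)) (s : State) : Prop where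
  dim : s.reg m = n
  common : ∀ u v : Fin n, s.arr 2 ((u : ℕ) * n + v) = commonCount G u v
  adj : ∀ u v : Fin n, s.arr m ((u : ℕ) * n + v) = posIndicator G u v

lemma HasGraph.congr {m : ℕ} {G : SimpleGraph (Fin n)} {s s' : State} (h : HasGraph m G s)
    (h1 : s'.reg m = s.reg m) (h2 : s'.arr 2 = s.arr 2) (h3 : s'.arr m = s.arr m) :
    HasGraph m G s' :=
  ⟨h1.trans h.dim, fun u v => by rw [h2, h.common], fun u v => by rw [h3, h.adj]⟩

/-- The correlation distance of two vertices in registers. -/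
def distExpr (m x y : ℕ) : Expr :=
  .op .sub (.const 1) (.op .div (matrixCell 2 m x y)
    (.op .sub (.op .add (matrixCell 2 m x x) (matrixCell 2 m y y)) (matrixCell 2 m x y)))

lemma HasGraph.eval_distExpr {m x y : ℕ} {G : SimpleGraph (Fin n)} {s : State}
    (h : HasGraph m G s) {u v : Fin n} (hx : s.reg x = (u : ℕ)) (hy : s.reg y = (v : ℕ)) :
    (distExpr m x y).eval s = some (corrMetric G u v) := by
  have hne := commonCount_union_ne_zero G u v
  simp only [distExpr, Expr.eval, eval_matrixCell h.dim hx hy, eval_matrixCell h.dim hx hx,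
    eval_matrixCell h.dim hy hy, h.common, Op.apply, Option.bind_some, if_neg hne,
    corrMetric_eq_commonCount]

/-- The indicator of a close negative neighbor. -/
def closeExpr (m x y : ℕ) : Expr :=
  .op .mul (.op .sub (.const 1) (matrixCell m m x y))
    (.op .sub (.const 1) (.op .lt (.const (7 / 10)) (distExpr m x y)))

/-- The indicator of an isolated vertex, whose number of close negative neighbors is in the
register `c`. -/
def isoExpr (m x c : ℕ) : Expr :=
  .op .sub (.const 1) (.op .lt (.reg c) (.op .mul (.const (10 / 3)) (matrixCell 2 m x x)))

/-- The positive values of this expression indicate the pairs of distance `1`. -/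
def farExpr (m x y : ℕ) : Expr :=
  .op .lt (.const 0) (.op .add (.op .add (.cell (m + 1) (.reg x)) (.cell (m + 1) (.reg y)))
    (.op .mul (.op .sub (.const 1) (matrixCell m m x y))
      (.op .lt (.const (7 / 10)) (distExpr m x y))))

/-- The adjusted correlation distance of two vertices in registers. -/
def metricExpr (m x y : ℕ) : Expr :=
  .op .mul (.op .sub (.const 1) (.op .eq (.reg x) (.reg y)))
    (.op .add (farExpr m x y)
      (.op .mul (.op .sub (.const 1) (farExpr m x y)) (distExpr m x y)))

/-- The contribution of one vertex to the centrality of another one. -/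
def proximityExpr (m x y : ℕ) : Expr :=
  .op .mul (.op .lt (metricExpr m x y) (.const (1 / 5)))
    (.op .sub (.const (1 / 5)) (metricExpr m x y))

lemma steps_closeExpr (m x y : ℕ) : (closeExpr m x y).steps ≤ 60 := by
  simp [closeExpr, distExpr, matrixCell, Expr.steps]

lemma steps_isoExpr (m x y : ℕ) : (isoExpr m x y).steps ≤ 20 := by
  simp [isoExpr, matrixCell, Expr.steps]

lemma steps_metricExpr (m x y : ℕ) : (metricExpr m x y).steps ≤ 200 := by
  simp [metricExpr, farExpr, distExpr, matrixCell, Expr.steps]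

lemma steps_proximityExpr (m x y : ℕ) : (proximityExpr m x y).steps ≤ 500 := by
  have := steps_metricExpr m x y
  simp only [proximityExpr, Expr.steps]
  omega

lemma HasGraph.eval_closeExpr {m x y : ℕ} {G : SimpleGraph (Fin n)} {s : State}
    (h : HasGraph m G s) {u v : Fin n} (hx : s.reg x = (u : ℕ)) (hy : s.reg y = (v : ℕ)) :
    (closeExpr m x y).eval s = some ((1 - posIndicator G u v) *
      (1 - if 7 / 10 < corrMetric G u v then 1 else 0)) := by
  simp only [closeExpr, Expr.eval, eval_matrixCell h.dim hx hy, h.eval_distExpr hx hy, h.adj,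
    Op.apply, Option.bind_some]

lemma HasGraph.eval_isoExpr {m x c : ℕ} {G : SimpleGraph (Fin n)} {s : State}
    (h : HasGraph m G s) {u : Fin n} (hx : s.reg x = (u : ℕ))
    (hc : s.reg c = ∑ v, (1 - posIndicator G u v) *
      (1 - if 7 / 10 < corrMetric G u v then 1 else 0)) :
    (isoExpr m x c).eval s = some (isoIndicator G u) := by
  simp only [isoExpr, Expr.eval, eval_matrixCell h.dim hx hx, h.common, hc,
    Op.apply, Option.bind_some, isoIndicator_eq]

/-- Moreover, the state holds the indicator function of the isolated vertices in the array
`m + 1`. -/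
structure HasMetric (m : ℕ) (G : SimpleGraph (Fin n)) (s : State) : Prop extends HasGraph m G s where
  iso : ∀ u : Fin n, s.arr (m + 1) (u : ℕ) = isoIndicator G u

lemma HasMetric.congr {m : ℕ} {G : SimpleGraph (Fin n)} {s s' : State} (h : HasMetric m G s)
    (h1 : s'.reg m = s.reg m) (h2 : s'.arr 2 = s.arr 2) (h3 : s'.arr m = s.arr m)
    (h4 : s'.arr (m + 1) = s.arr (m + 1)) : HasMetric m G s' :=
  ⟨h.toHasGraph.congr h1 h2 h3, fun u => by rw [h4, h.iso]⟩

lemma HasMetric.eval_metricExpr {m x y : ℕ} {G : SimpleGraph (Fin n)} {s : State}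
    (h : HasMetric m G s) {u v : Fin n} (hx : s.reg x = (u : ℕ)) (hy : s.reg y = (v : ℕ)) :
    (metricExpr m x y).eval s = some (adjCorrMetric G u v) := by
  have huv : ((u : ℕ) : ℚ) = ((v : ℕ) : ℚ) ↔ u = v := by
    rw [Nat.cast_inj, Fin.val_inj]
  rw [adjCorrMetric_eq]
  simp only [metricExpr, farExpr, Expr.eval, eval_matrixCell h.dim hx hy, h.eval_distExpr hx hy,
    h.adj, hx, hy, index_natCast, Option.map_some, h.iso, Op.apply, Option.bind_some, huv]
  congr

lemma HasMetric.eval_proximityExpr {m x y : ℕ} {G : SimpleGraph (Fin n)} {s : State}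
    (h : HasMetric m G s) {u v : Fin n} (hx : s.reg x = (u : ℕ)) (hy : s.reg y = (v : ℕ)) :
    (proximityExpr m x y).eval s = some (proximity G u v) := by
  simp only [proximityExpr, Expr.eval, h.eval_metricExpr hx hy, Op.apply, Option.bind_some,
    proximity_eq]

end Expressions

end RatRAM

namespace RatRAM

open CorrelationClustering

/-! ### The rounding algorithm as a program with quadratic running time -/

section RoundingProgram

variable {n : ℕ}

/-- The state of the rounding algorithm when `S` is the set of unclustered vertices: their number is
in the register `m + 6`, the centralities are in the array `m + 2`, and the nonzero entries of the
array `m + 3` indicate the clustered vertices. -/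
structure HasUnclustered (m : ℕ) (G : SimpleGraph (Fin n)) (S : Finset (Fin n)) (s : State) : Prop
    extends HasMetric m G s where
  count : s.reg (m + 6) = S.card
  clustered : ∀ u : Fin n, s.arr (m + 3) (u : ℕ) = if u ∈ S then 0 else 1
  centr : ∀ u : Fin n, s.arr (m + 2) (u : ℕ) = ∑ v ∈ S, proximity G u v

lemma HasUnclustered.congr {m : ℕ} {G : SimpleGraph (Fin n)} {S : Finset (Fin n)} {s s' : State}
    (h : HasUnclustered m G S s) (h1 : s'.reg m = s.reg m) (h2 : s'.reg (m + 6) = s.reg (m + 6))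
    (h3 : s'.arr = s.arr) : HasUnclustered m G S s' := by
  obtain ⟨h4, h5, h6, h7⟩ := h
  refine ⟨h4.congr h1 ?_ ?_ ?_, h2.trans h5, ?_, ?_⟩ <;> rw [h3] <;> assumption

/-- The program that removes the vertex in the register `m + 1` from the centralities. -/
def updateProg (m : ℕ) : Prog :=
  forLoop (m + 2) (.reg m) (.store (m + 2) (.reg (m + 2))
    (.op .sub (.cell (m + 2) (.reg (m + 2))) (proximityExpr m (m + 2) (m + 1))))

lemma spec_updateProg {m : ℕ} (hm : 3 ≤ m) {G : SimpleGraph (Fin n)} {s : State}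
    (h : HasMetric m G s) {v : Fin n} (hv : s.reg (m + 1) = (v : ℕ)) :
    Spec (updateProg m) s (520 * (n + 1)) fun s' => (∀ x, x ≠ m + 2 → s'.reg x = s.reg x) ∧
      (∀ a, a ≠ m + 2 → s'.arr a = s.arr a) ∧
      ∀ u : Fin n, s'.arr (m + 2) (u : ℕ) = s.arr (m + 2) (u : ℕ) - proximity G u v := by
  refine Spec.forLoop (N := n) (fun _ => 505)
    (fun k s' => s'.reg (m + 2) = k ∧ (∀ x, x ≠ m + 2 → s'.reg x = s.reg x) ∧
      (∀ a, a ≠ m + 2 → s'.arr a = s.arr a) ∧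
      ∀ u : Fin n, s'.arr (m + 2) (u : ℕ) =
        if (u : ℕ) < k then s.arr (m + 2) (u : ℕ) - proximity G u v else s.arr (m + 2) (u : ℕ))
    ⟨by simp, fun x hx => by simp [hx], fun _ _ => rfl, fun u => by simp⟩ ?_ ?_ ?_ ?_
  · rintro k _ s' ⟨h1, h2, -, -⟩
    refine ⟨h1, ?_⟩
    simp only [Expr.eval]
    rw [h2 m (by omega), h.dim]
  · rintro k hk s' ⟨h1, h2, h3, h4⟩
    have hM : HasMetric m G s' := h.congr (h2 _ (by omega)) (h3 _ (by omega)) (h3 _ (by omega))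
      (h3 _ (by omega))
    have hp := hM.eval_proximityExpr (x := m + 2) (y := m + 1) (u := ⟨k, hk⟩) (v := v) h1
      ((h2 _ (by omega)).trans hv)
    have hL : s'.arr (m + 2) k = s.arr (m + 2) k := by simpa using h4 ⟨k, hk⟩
    refine Spec.store (k := k) (q := s.arr (m + 2) k - proximity G ⟨k, hk⟩ v) ?_ ?_
      ⟨h1, by simp, fun x hx => ?_, fun a ha => ?_, fun u => ?_⟩ ?_
    · simp only [Expr.eval, h1]
    · simp only [Expr.eval, h1, hp, Op.apply, Option.bind_some, index_natCast, Option.map_some, hL]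
    · simp [hx, h2 x hx]
    · rw [State.setReg_arr, State.setCell_arr_of_ne _ _ _ ha]
      exact h3 a ha
    · rw [State.setReg_arr, State.setCell_arr, h4]
      by_cases hu : (u : ℕ) = k
      · obtain rfl : u = ⟨k, hk⟩ := Fin.ext hu
        simp
      · rw [if_neg (by tauto)]
        by_cases hu' : (u : ℕ) < k
        · rw [if_pos hu', if_pos (by omega)]
        · rw [if_neg hu', if_neg (by omega)]
    · have := steps_proximityExpr m (m + 2) (m + 1)
      simp only [Expr.steps]
      omega
  · rintro s' ⟨-, h2, h3, h4⟩
    exact ⟨h2, h3, fun u => by rw [h4, if_pos u.2]⟩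
  · simp [Expr.steps]; omega

/-- The program that moves the vertex in the register `m + 1` to the cluster whose label is in the
register `m + 4`. -/
def removeProg (m : ℕ) : Prog :=
  .seq (.store (m + 3) (.reg (m + 1)) (.const 1))
    (.seq (.store 1 (.reg (m + 1)) (.reg (m + 4)))
      (.seq (.assign (m + 6) (.op .sub (.reg (m + 6)) (.const 1))) (updateProg m)))

/-- Removing v subtracts one proximity from every centrality, in linear time. Each vertex is removed
only once, so this is quadratic over the whole run. -/
lemma spec_removeProg {m : ℕ} (hm : 3 ≤ m) {G : SimpleGraph (Fin n)} {S : Finset (Fin n)}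
    {s : State} (h : HasUnclustered m G S s) {v : Fin n} (hv : s.reg (m + 1) = (v : ℕ))
    (hvS : v ∈ S) : Spec (removeProg m) s (530 * (n + 1)) fun s' =>
      HasUnclustered m G (S.erase v) s' ∧
      (∀ x, x ≠ m + 2 → x ≠ m + 6 → s'.reg x = s.reg x) ∧
      ∀ k, s'.arr 1 k = if k = v then s.reg (m + 4) else s.arr 1 k := by
  refine Spec.seq (b₁ := 3) (b₂ := 7 + 520 * (n + 1)) (Spec.store (k := v) (q := 1) ?_ rfl ?_
    (by simp [Expr.steps])) (by omega)
  · simp only [Expr.eval, hv]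
  refine Spec.seq (b₁ := 3) (b₂ := 4 + 520 * (n + 1)) (Spec.store (k := v) (q := s.reg (m + 4))
    ?_ rfl ?_ (by simp [Expr.steps])) (by omega)
  · simp only [Expr.eval, State.setCell_reg, hv]
  refine Spec.seq (b₁ := 4) (b₂ := 520 * (n + 1)) (Spec.assign (q := s.reg (m + 6) - 1) rfl ?_
    (by simp [Expr.steps])) (by omega)
  set s₁ := ((s.setCell (m + 3) v 1).setCell 1 v (s.reg (m + 4))).setReg (m + 6)
    (s.reg (m + 6) - 1) with hs₁
  have hr : ∀ x, x ≠ m + 6 → s₁.reg x = s.reg x := fun x hx => by simp [hs₁, hx]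
  have ha : ∀ a, a ≠ 1 → a ≠ m + 3 → s₁.arr a = s.arr a := fun a h1 h2 => by
    rw [hs₁, State.setReg_arr, State.setCell_arr_of_ne _ _ _ h1, State.setCell_arr_of_ne _ _ _ h2]
  have hM : HasMetric m G s₁ := h.toHasMetric.congr (hr _ (by omega)) (ha _ (by omega) (by omega))
    (ha _ (by omega) (by omega)) (ha _ (by omega) (by omega))
  refine (spec_updateProg hm hM (v := v) ((hr _ (by omega)).trans hv)).mono le_rfl ?_
  rintro s' ⟨h1, h2, h3⟩
  refine ⟨⟨hM.congr (h1 _ (by omega)) (h2 _ (by omega)) (h2 _ (by omega)) (h2 _ (by omega)),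
    ?_, fun u => ?_, fun u => ?_⟩, fun x hx hx' => ?_, fun k => ?_⟩
  · rw [h1 _ (by omega), Finset.card_erase_of_mem hvS, Nat.cast_sub (Finset.card_pos.2 ⟨v, hvS⟩)]
    simp [hs₁, h.count]
  · rw [h2 _ (by omega), hs₁, State.setReg_arr, State.setCell_arr, State.setCell_arr,
      if_neg (by omega), h.clustered]
    by_cases huv : u = v
    · simp [huv]
    · have : (u : ℕ) ≠ v := fun e => huv (Fin.ext e)
      simp [huv, this]
  · rw [h3, ha _ (by omega) (by omega), h.centr, ← Finset.sum_erase_add _ _ hvS]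
    ring
  · rw [h1 x hx, hr x hx']
  · rw [h2 _ (by omega), hs₁, State.setReg_arr, State.setCell_arr, State.setCell_arr,
      if_neg (by omega : ¬ (1 = m + 3 ∧ k = (v : ℕ)))]
    simp

/-- The test whether the vertex in the register `m + 1` is an unclustered vertex of the ball around
the vertex in the register `m + 4`. -/
def clusterCond (m : ℕ) : Expr :=
  .op .mul (.op .sub (.const 1) (.cell (m + 3) (.reg (m + 1))))
    (.op .sub (.const 1) (.op .lt (.const (2 / 5)) (metricExpr m (m + 4) (m + 1))))

lemma steps_clusterCond (m : ℕ) : (clusterCond m).steps ≤ 220 := by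
  have := steps_metricExpr m (m + 4) (m + 1)
  simp only [clusterCond, Expr.steps]
  omega

lemma eval_clusterCond {m : ℕ} {G : SimpleGraph (Fin n)} {S : Finset (Fin n)} {s : State}
    (h : HasUnclustered m G S s) {v w : Fin n} (hv : s.reg (m + 1) = (v : ℕ))
    (hw : s.reg (m + 4) = (w : ℕ)) :
    (clusterCond m).eval s = some (if v ∈ S ∧ adjCorrMetric G w v ≤ 2 / 5 then 1 else 0) := by
  simp only [clusterCond, Expr.eval, hv, index_natCast, Option.map_some, Option.bind_some,
    h.eval_metricExpr hw hv, Op.apply, h.clustered, ← not_lt]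
  by_cases h1 : v ∈ S <;> by_cases h2 : 2 / 5 < adjCorrMetric G w v <;> simp [h1, h2]

/-- The program that moves the ball around the vertex in the register `m + 4` to a new cluster. -/
def clusterProg (m : ℕ) : Prog :=
  forLoop (m + 1) (.reg m) (.ite (clusterCond m) (removeProg m) .skip)

lemma spec_clusterProg {m : ℕ} (hm : 3 ≤ m) {G : SimpleGraph (Fin n)} {S : Finset (Fin n)}
    {s : State} (h : HasUnclustered m G S s) {w : Fin n} (hw : s.reg (m + 4) = (w : ℕ)) :
    Spec (clusterProg m) s
      (240 * (n + 1) + 530 * (n + 1) * (S.filter fun v => adjCorrMetric G w v ≤ 2 / 5).card)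
      fun s' => HasUnclustered m G (S.filter fun v => ¬ adjCorrMetric G w v ≤ 2 / 5) s' ∧
        ∀ v : Fin n, s'.arr 1 (v : ℕ) =
          if v ∈ S ∧ adjCorrMetric G w v ≤ 2 / 5 then ((w : ℕ) : ℚ) else s.arr 1 (v : ℕ) := by
  set B := S.filter fun v => adjCorrMetric G w v ≤ 2 / 5 with hB
  -- What is left of S after the vertices below k have been scanned. The unscanned vertex k belongs
  -- to it exactly if it belongs to S.
  set T : ℕ → Finset (Fin n) := fun k =>
    S.filter fun v => ¬ ((v : ℕ) < k ∧ adjCorrMetric G w v ≤ 2 / 5) with hT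
  refine Spec.forLoop (N := n)
    -- Only members of the ball incur the linear cost of a removal.
    (fun k => 230 + if k ∈ B.image Fin.val then 530 * (n + 1) else 0)
    (fun k s' => s'.reg (m + 1) = k ∧ s'.reg (m + 4) = (w : ℕ) ∧ HasUnclustered m G (T k) s' ∧
      ∀ v : Fin n, s'.arr 1 (v : ℕ) = if v ∈ S ∧ (v : ℕ) < k ∧ adjCorrMetric G w v ≤ 2 / 5
        then ((w : ℕ) : ℚ) else s.arr 1 (v : ℕ)) ⟨by simp, by simp [hw], ?_, by simp⟩ ?_ ?_ ?_ ?_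
  · have : T 0 = S := by simp [hT]
    rw [this]
    exact h.congr (by simp) (by simp) rfl
  · rintro k _ s' ⟨h1, -, h2, -⟩
    exact ⟨h1, by simp only [Expr.eval, h2.dim]⟩
  · rintro k hk s' ⟨h1, h2, h3, h4⟩
    set v : Fin n := ⟨k, hk⟩ with hv
    have hvT : v ∈ T k ↔ v ∈ S := by simp [hT, hv]
    have hcond : (clusterCond m).eval s' = some (if v ∈ B then 1 else 0) := by
      rw [eval_clusterCond h3 (v := v) h1 h2]
      simp only [hvT, hB, Finset.mem_filter]
    have hvB : k ∈ B.image Fin.val ↔ v ∈ B := by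
      simp only [Finset.mem_image]
      exact ⟨fun ⟨x, hx, hxk⟩ => (Fin.ext hxk : x = v) ▸ hx, fun hx => ⟨v, hx, rfl⟩⟩
    have hsteps := steps_clusterCond m
    have hlt : ∀ u : Fin n, (u : ℕ) < k + 1 ↔ (u : ℕ) < k ∨ u = v := fun u => by
      rw [Fin.ext_iff]; simp only [hv]; omega
    simp only [hvB]
    by_cases hmem : v ∈ B
    · rw [if_pos hmem] at hcond ⊢
      have hmem' := Finset.mem_filter.1 hmem
      refine Spec.iteTrue hcond one_ne_zero ((spec_removeProg hm h3 (v := v) h1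
        (hvT.2 hmem'.1)).mono le_rfl ?_) (by omega)
      rintro s'' ⟨h5, h6, h7⟩
      refine ⟨(h6 _ (by omega) (by omega)).trans h1, by simp, ?_, ?_, fun u => ?_⟩
      · simp [h6 (m + 4) (by omega) (by omega), h2]
      · have : T (k + 1) = (T k).erase v := by
          ext u
          simp only [hT, Finset.mem_filter, Finset.mem_erase, hlt]
          by_cases huv : u = v
          · subst huv; simp [hmem'.2]
          · simp [huv]
        rw [this]
        exact h5.congr (by simp) (by simp) rfl
      · rw [State.setReg_arr, h7, h4, h2]
        simp only [hlt]
        by_cases huv : u = v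
        · subst huv; simp [hmem'.1, hmem'.2]
        · have : (u : ℕ) ≠ v := fun e => huv (Fin.ext e)
          simp [huv, this]
    · rw [if_neg hmem] at hcond ⊢
      have hmem' : ¬ (v ∈ S ∧ adjCorrMetric G w v ≤ 2 / 5) := fun h => hmem (Finset.mem_filter.2 h)
      refine Spec.iteFalse hcond (Spec.skip (b := 1) ⟨h1, by simp, by simp [h2], ?_, fun u => ?_⟩
        le_rfl) (by omega)
      · have : T (k + 1) = T k := by
          ext u
          simp only [hT, Finset.mem_filter, hlt]
          exact and_congr_right fun huS => not_congr (and_congr_left fun hf =>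
            ⟨fun h => h.resolve_right fun e => hmem' (e ▸ ⟨huS, hf⟩), Or.inl⟩)
        rw [this]
        exact h3.congr (by simp) (by simp) rfl
      · rw [State.setReg_arr, h4]
        simp only [hlt]
        by_cases huv : u = v
        · subst huv
          rw [if_neg fun h => hmem' ⟨h.1, h.2.2⟩, if_neg fun h => hmem' ⟨h.1, h.2.2⟩]
        · simp [huv]
  · rintro s' ⟨-, -, h3, h4⟩
    refine ⟨?_, fun v => ?_⟩
    · have : T n = S.filter fun v => ¬ adjCorrMetric G w v ≤ 2 / 5 := by simp [hT]
      rwa [this] at h3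
    · rw [h4]; simp
  · have h1 : ∑ k ∈ Finset.range n, (if k ∈ B.image Fin.val then 530 * (n + 1) else 0) ≤
        530 * (n + 1) * B.card := by
      rw [← Finset.sum_filter, Finset.sum_const, smul_eq_mul, mul_comm]
      refine Nat.mul_le_mul_left _ ((Finset.card_le_card ?_).trans
        (Finset.card_image_le (f := Fin.val)))
      exact fun x hx => (Finset.mem_filter.1 hx).2
    rw [Finset.sum_add_distrib]
    simp only [Finset.sum_const, Finset.card_range, smul_eq_mul, Expr.steps]
    omega

/-- The test whether the vertex in the register `m + 1` is an unclustered vertex whose centrality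
exceeds the value in the register `m + 5`. -/
def centerCond (m : ℕ) : Expr :=
  .op .mul (.op .sub (.const 1) (.cell (m + 3) (.reg (m + 1))))
    (.op .lt (.reg (m + 5)) (.cell (m + 2) (.reg (m + 1))))

lemma eval_centerCond {m : ℕ} {G : SimpleGraph (Fin n)} {S : Finset (Fin n)} {s : State}
    (h : HasUnclustered m G S s) {v : Fin n} (hv : s.reg (m + 1) = (v : ℕ)) :
    (centerCond m).eval s =
      some (if v ∈ S ∧ s.reg (m + 5) < ∑ x ∈ S, proximity G v x then 1 else 0) := by
  simp only [centerCond, Expr.eval, hv, index_natCast, Option.map_some, Option.bind_some,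
    Op.apply, h.clustered, h.centr]
  by_cases h1 : v ∈ S <;> by_cases h2 : s.reg (m + 5) < ∑ x ∈ S, proximity G v x <;>
    simp [h1, h2]

/-- The program that finds the next cluster center. -/
def centerProg (m : ℕ) : Prog :=
  .seq (.assign (m + 5) (.const (-1))) (forLoop (m + 1) (.reg m) (.ite
    (centerCond m)
    (.seq (.assign (m + 5) (.cell (m + 2) (.reg (m + 1)))) (.assign (m + 4) (.reg (m + 1)))) .skip))

lemma spec_centerProg {m : ℕ} {G : SimpleGraph (Fin n)} {S : Finset (Fin n)} {s : State}
    (h : HasUnclustered m G S s) (hS : S.Nonempty) :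
    Spec (centerProg m) s (40 * (n + 1)) fun s' => HasUnclustered m G S s' ∧ s'.arr = s.arr ∧
      ∃ w ∈ S, s'.reg (m + 4) = (w : ℕ) ∧
        ∀ v ∈ S, ∑ x ∈ S, proximity G v x ≤ ∑ x ∈ S, proximity G w x := by
  set L : Fin n → ℚ := fun u => ∑ x ∈ S, proximity G u x with hL
  have hL0 : ∀ u, 0 ≤ L u := fun u => Finset.sum_nonneg fun x _ => proximity_nonneg G u x
  -- Centralities are nonnegative, so the start value -1 is beaten by the first unclustered vertex.
  refine Spec.seq (b₁ := 2) (b₂ := 38 * (n + 1)) (Spec.assign (q := -1) rfl ?_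
    (by simp [Expr.steps])) (by omega)
  refine Spec.forLoop (N := n) (fun _ => 20)
    (fun k s' => s'.reg (m + 1) = k ∧ HasUnclustered m G S s' ∧ s'.arr = s.arr ∧
      (∀ v ∈ S, (v : ℕ) < k → L v ≤ s'.reg (m + 5)) ∧
      ((s'.reg (m + 5) = -1 ∧ ∀ v ∈ S, ¬ (v : ℕ) < k) ∨
        ∃ w ∈ S, s'.reg (m + 4) = (w : ℕ) ∧ s'.reg (m + 5) = L w))
    ⟨by simp, h.congr (by simp) (by simp) rfl, rfl, by simp, Or.inl (by simp)⟩ ?_ ?_ ?_ ?_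
  · rintro k _ s' ⟨h1, h2, -⟩
    exact ⟨h1, by simp only [Expr.eval, h2.dim]⟩
  · rintro k hk s' ⟨h1, h2, h3, h4, h5⟩
    set v : Fin n := ⟨k, hk⟩ with hv
    have hLk : s'.arr (m + 2) k = L v := h2.centr v
    have hcond : (centerCond m).eval s' =
        some (if v ∈ S ∧ s'.reg (m + 5) < L v then 1 else 0) := eval_centerCond h2 (v := v) h1
    have hlt : ∀ u : Fin n, (u : ℕ) < k + 1 ↔ (u : ℕ) < k ∨ u = v := fun u => by
      rw [Fin.ext_iff]; simp only [hv]; omega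
    by_cases hmem : v ∈ S ∧ s'.reg (m + 5) < L v
    · rw [if_pos hmem] at hcond
      refine Spec.iteTrue (b := 5) hcond one_ne_zero (Spec.seq (b₁ := 3) (b₂ := 2)
        (Spec.assign (q := L v) ?_ (Spec.assign (q := (k : ℚ)) ?_ ?_ ?_) ?_) le_rfl) ?_
      · simp only [Expr.eval, h1, index_natCast, Option.map_some, Option.bind_some, hLk]
      · simp [Expr.eval, h1]
      · refine ⟨by simp [h1], by simp, h2.congr (by simp) (by simp) rfl, h3, ?_,
          Or.inr ⟨v, hmem.1, by simp [hv], by simp⟩⟩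
        intro u hu huk
        have : L u ≤ L v := by
          rcases (hlt u).1 huk with h | h
          · exact (h4 u hu h).trans hmem.2.le
          · rw [h]
        simpa using this
      all_goals simp [centerCond, Expr.steps]
    · rw [if_neg hmem] at hcond
      refine Spec.iteFalse hcond (Spec.skip (b := 1) ⟨h1, by simp,
        h2.congr (by simp) (by simp) rfl, h3, ?_, ?_⟩ le_rfl) (by simp [centerCond, Expr.steps])
      · intro u hu huk
        have : L u ≤ s'.reg (m + 5) := by
          rcases (hlt u).1 huk with h | h
          · exact h4 u hu h
          · subst h; exact not_lt.1 fun h' => hmem ⟨hu, h'⟩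
        simpa using this
      · rcases h5 with ⟨h5, h6⟩ | ⟨w, hw, h5, h6⟩
        · refine Or.inl ⟨by simpa using h5, fun u hu huk => ?_⟩
          rcases (hlt u).1 huk with h | h
          · exact h6 u hu h
          · subst h
            exact hmem ⟨hu, by rw [h5]; linarith [hL0 v]⟩
        · exact Or.inr ⟨w, hw, by simpa using h5, by simpa using h6⟩
  · rintro s' ⟨-, h2, h3, h4, h5⟩
    refine ⟨h2, h3, ?_⟩
    rcases h5 with ⟨-, h6⟩ | ⟨w, hw, h5, h6⟩
    · obtain ⟨v, hv⟩ := hS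
      exact absurd v.2 (h6 v hv)
    · exact ⟨w, hw, h5, fun v hv => (h4 v hv v.2).trans h6.le⟩
  · simp [Expr.steps]; omega

/-- The program for the rounding algorithm. -/
def roundingProg (m : ℕ) : Prog :=
  .while (.op .lt (.const 0) (.reg (m + 6))) (.seq (centerProg m) (clusterProg m))

/-- A cluster is labeled by the index of its center. Labels given later are indices of vertices that
remain unclustered, so they never collide with an earlier center; the clause that labels of S come
from S carries this through the induction. -/
lemma spec_roundingProg {m : ℕ} (hm : 3 ≤ m) {G : SimpleGraph (Fin n)} :
    ∀ (S : Finset (Fin n)) (s : State), HasUnclustered m G S s →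
      Spec (roundingProg m) s (820 * (n + 1) * S.card + 4) fun s' =>
        ∃ Cs, RoundingRun (adjCorrMetric G) (1 / 5) S Cs ∧
          (∀ v : Fin n, v ∉ S → s'.arr 1 (v : ℕ) = s.arr 1 (v : ℕ)) ∧
          (∀ v ∈ S, ∃ u ∈ S, s'.arr 1 (v : ℕ) = (u : ℕ)) ∧
          ∀ u ∈ S, ∀ v ∈ S, (s'.arr 1 (u : ℕ) = s'.arr 1 (v : ℕ) ↔ SameCluster Cs u v) := by
  intro S
  induction S using Finset.strongInduction with
  | H S ih =>
  intro s h
  rcases S.eq_empty_or_nonempty with rfl | hS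
  · refine ⟨4, s, .whileFalse _ _ s ?_, by omega, [], .done, fun _ _ => rfl, by simp, by simp⟩
    simp [Expr.eval, h.count, Op.apply]
  obtain ⟨t₁, s₁, run₁, ht₁, h₁, ha₁, w, hwS, hw, hmax⟩ := spec_centerProg h hS
  obtain ⟨t₂, s₂, run₂, ht₂, h₂, hl₂⟩ := spec_clusterProg hm h₁ hw
  set B := S.filter fun v => adjCorrMetric G w v ≤ 2 / 5 with hB
  set S' := S.filter fun v => ¬ adjCorrMetric G w v ≤ 2 / 5 with hS'
  have hwB : w ∈ B := Finset.mem_filter.2 ⟨hwS, by rw [adjCorrMetric_self]; norm_num⟩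
  have hwS' : w ∉ S' := fun hw' => (Finset.mem_filter.1 hw').2 (Finset.mem_filter.1 hwB).2
  have hsub : S' ⊂ S := Finset.ssubset_iff_subset_ne.2
    ⟨Finset.filter_subset _ _, fun e => hwS' (e ▸ hwS)⟩
  have hcard : B.card + S'.card = S.card := Finset.card_filter_add_card_filter_not _
  have hBpos : 1 ≤ B.card := Finset.card_pos.2 ⟨w, hwB⟩
  obtain ⟨t₃, s₃, run₃, ht₃, Cs, hrun, hout, hlab, hiff⟩ := ih S' hsub s₂ h₂
  have hcond : (Expr.op .lt (.const 0) (.reg (m + 6))).eval s = some 1 := by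
    have : (0 : ℚ) < S.card := Nat.cast_pos.2 (Finset.card_pos.2 hS)
    simp [Expr.eval, h.count, Op.apply, this]
  have hmemB : ∀ v, v ∈ ballIn (adjCorrMetric G) S w (2 * (1 / 5)) ↔ v ∈ B := fun v => by
    rw [mem_cluster, hB, Finset.mem_filter]
  have hsplit : ∀ v ∈ S, v ∉ S' → v ∈ B := fun v hv hv' =>
    Finset.mem_filter.2 ⟨hv, by_contra fun h => hv' (Finset.mem_filter.2 ⟨hv, h⟩)⟩
  have hdisj : ∀ v ∈ B, v ∉ S' := fun v hv hv' =>
    (Finset.mem_filter.1 hv').2 (Finset.mem_filter.1 hv).2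
  have hlabB : ∀ v ∈ B, s₃.arr 1 (v : ℕ) = (w : ℕ) := fun v hv => by
    rw [hout v (hdisj v hv), hl₂, if_pos (Finset.mem_filter.1 hv)]
  refine ⟨_, s₃, .whileTrue _ _ s s₂ s₃ 1 _ t₃ hcond one_ne_zero (.seq _ _ _ _ _ _ _ run₁ run₂)
    run₃, ?_, _, RoundingRun.step_of_mem_iff hwS ?_ ?_ hrun, ?_, ?_, ?_⟩
  · simp only [Expr.steps]
    -- The ball contains its center, so it has at least one element, and this pays for the two
    -- linear scans of the round.
    rw [← hcard]
    nlinarith [Nat.mul_le_mul_left (n + 1) hBpos]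
  · intro v hv
    rw [centrality_eq_sum, centrality_eq_sum]
    exact hmax v hv
  · intro v
    rw [hS', Finset.mem_filter]
    norm_num
  · intro v hv
    rw [hout v fun h => hv (hsub.subset h), hl₂, if_neg (by tauto), ha₁]
  · intro v hv
    by_cases hv' : v ∈ S'
    · obtain ⟨u, hu, h⟩ := hlab v hv'
      exact ⟨u, hsub.subset hu, h⟩
    · exact ⟨w, hwS, hlabB v (hsplit v hv hv')⟩
  · have hsep : ∀ u ∈ B, ∀ v ∈ S', s₃.arr 1 (u : ℕ) ≠ s₃.arr 1 (v : ℕ) ∧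
        ∀ A ∈ ballIn (adjCorrMetric G) S w (2 * (1 / 5)) :: Cs, ¬ (u ∈ A ∧ v ∈ A) := by
      intro u hu v hv
      refine ⟨fun e => ?_, fun A hA hA' => ?_⟩
      · obtain ⟨x, hx, hx'⟩ := hlab v hv
        rw [hlabB u hu, hx', Nat.cast_inj, Fin.val_inj] at e
        exact hwS' (e ▸ hx)
      · rcases List.mem_cons.1 hA with rfl | hA
        · exact hdisj v ((hmemB v).1 hA'.2) hv
        · exact hdisj u hu (hrun.subset A hA hA'.1)
    intro u hu v hv
    by_cases hu' : u ∈ S' <;> by_cases hv' : v ∈ S'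
    · rw [hiff u hu' v hv']
      refine ⟨fun ⟨A, hA, h⟩ => ⟨A, List.mem_cons_of_mem _ hA, h⟩, fun ⟨A, hA, h⟩ => ?_⟩
      rcases List.mem_cons.1 hA with rfl | hA
      · exact absurd hu' (hdisj u ((hmemB u).1 h.1))
      · exact ⟨A, hA, h⟩
    · obtain ⟨h1, h2⟩ := hsep v (hsplit v hv hv') u hu'
      exact ⟨fun e => absurd e.symm h1, fun ⟨A, hA, h⟩ => absurd h.symm (h2 A hA)⟩
    · obtain ⟨h1, h2⟩ := hsep u (hsplit u hu hu') v hv'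
      exact ⟨fun e => absurd e h1, fun ⟨A, hA, h⟩ => absurd h (h2 A hA)⟩
    · have hu'' := hsplit u hu hu'
      have hv'' := hsplit v hv hv'
      rw [hlabB u hu'', hlabB v hv'']
      exact ⟨fun _ => ⟨_, List.mem_cons_self, (hmemB u).2 hu'', (hmemB v).2 hv''⟩, fun _ => rfl⟩

end RoundingProgram

end RatRAM

namespace RatRAM

open CorrelationClustering

/-! ### Preparation of the input, the quadratic lower bound and the complete program -/

section Main

variable {n : ℕ}

lemma mul_add_lt_mul (u v : Fin n) : (u : ℕ) * n + v < n * n := by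
  have h := (finProdFinEquiv (u, v)).2
  rw [finProdFinEquiv_apply_val] at h
  simp only at h
  rw [mul_comm (u : ℕ)]; omega

lemma mul_add_inj {u v u' v' : Fin n} :
    (u : ℕ) * n + v = (u' : ℕ) * n + v' ↔ u = u' ∧ v = v' := by
  refine ⟨fun h => ?_, by rintro ⟨rfl, rfl⟩; rfl⟩
  have : finProdFinEquiv (u, v) = finProdFinEquiv (u', v') := by
    ext
    simp only [finProdFinEquiv_apply_val]
    rw [mul_comm n, mul_comm n]; omega
  simpa using finProdFinEquiv.injective this

lemma exists_eq_mul_add {k : ℕ} (hk : k < n * n) : ∃ u v : Fin n, k = (u : ℕ) * n + v := by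
  refine ⟨(finProdFinEquiv.symm ⟨k, hk⟩).1, (finProdFinEquiv.symm ⟨k, hk⟩).2, ?_⟩
  have h := congrArg Fin.val (finProdFinEquiv.apply_symm_apply (⟨k, hk⟩ : Fin (n * n)))
  rw [finProdFinEquiv_apply_val] at h
  rw [mul_comm _ n]
  simp only at h
  omega

lemma matrixArray_mul_add (A : Matrix (Fin n) (Fin n) ℚ) (u v : Fin n) :
    matrixArray A ((u : ℕ) * n + v) = A u v := by
  have h : finProdFinEquiv.symm ⟨(u : ℕ) * n + v, mul_add_lt_mul u v⟩ = (u, v) := by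
    rw [Equiv.symm_apply_eq]
    ext
    simp only [finProdFinEquiv_apply_val]
    ring
  rw [matrixArray, dif_pos (mul_add_lt_mul u v), h]

lemma matrixArray_of_le (A : Matrix (Fin n) (Fin n) ℚ) {k : ℕ} (h : n * n ≤ k) :
    matrixArray A k = 0 := dif_neg (by omega)

lemma eq_matrixArray {A : Matrix (Fin n) (Fin n) ℚ} {f : ℕ → ℚ}
    (h1 : ∀ u v : Fin n, f ((u : ℕ) * n + v) = A u v) (h2 : ∀ k, n * n ≤ k → f k = 0) :
    f = matrixArray A := by
  funext k
  by_cases hk : k < n * n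
  · obtain ⟨u, v, rfl⟩ := exists_eq_mul_add hk
    rw [h1, matrixArray_mul_add]
  · rw [h2 k (by omega), matrixArray_of_le A (by omega)]

/-- Since the product has to be written, matrix multiplication takes at least `n ^ 2` steps. -/
lemma sq_le_of_runs {P : Prog} {t : ℕ} {s : State} (hn : 0 < n)
    (h : Runs P (input (Matrix.of fun _ _ : Fin n => 1) (Matrix.of fun _ _ => 1)) t s)
    (hs : ∀ i j : Fin n, s.arr 2 ((i : ℕ) * n + j) =
      ((Matrix.of fun _ _ : Fin n => (1 : ℚ)) * Matrix.of fun _ _ : Fin n => (1 : ℚ)) i j) :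
    n * n ≤ t := by
  obtain ⟨F, hF, hF'⟩ := h.exists_card_le 2
  refine le_trans ?_ hF
  rw [← Finset.card_range (n * n)]
  refine Finset.card_le_card fun k hk => ?_
  obtain ⟨u, v, rfl⟩ := exists_eq_mul_add (Finset.mem_range.1 hk)
  -- An untouched cell still holds the initial 0, whereas every entry of the product of all-ones
  -- matrices is n.
  by_contra hkF
  have h1 := hF' _ hkF
  rw [hs, Matrix.mul_apply] at h1
  simp [input] at h1
  omega

/-- The program that adds the positive self-loops to the adjacency matrix in the array `0` and
copies it to the arrays `1` and `m`. -/
def prepProg (m : ℕ) : Prog :=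
  .seq (.assign m (.reg 0)) (.seq
    (forLoop (m + 1) (.reg 0)
      (.store 0 (.op .add (.op .mul (.reg (m + 1)) (.reg 0)) (.reg (m + 1))) (.const 1)))
    (forLoop (m + 1) (.op .mul (.reg 0) (.reg 0))
      (.seq (.store 1 (.reg (m + 1)) (.cell 0 (.reg (m + 1))))
        (.store m (.reg (m + 1)) (.cell 0 (.reg (m + 1)))))))

lemma spec_diagonal {m : ℕ} (hm : 3 ≤ m) {s : State} (hs : s.reg 0 = n) :
    Spec (forLoop (m + 1) (.reg 0)
      (.store 0 (.op .add (.op .mul (.reg (m + 1)) (.reg 0)) (.reg (m + 1))) (.const 1))) s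
      (17 * n + 10) fun s' => (∀ x, x ≠ m + 1 → s'.reg x = s.reg x) ∧
        (∀ a, a ≠ 0 → s'.arr a = s.arr a) ∧
        (∀ u v : Fin n, s'.arr 0 ((u : ℕ) * n + v) =
          if u = v then 1 else s.arr 0 ((u : ℕ) * n + v)) ∧
        ∀ k, n * n ≤ k → s'.arr 0 k = s.arr 0 k := by
  refine Spec.forLoop (N := n) (fun _ => 7)
    (fun k s' => s'.reg (m + 1) = k ∧ (∀ x, x ≠ m + 1 → s'.reg x = s.reg x) ∧
        (∀ a, a ≠ 0 → s'.arr a = s.arr a) ∧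
        (∀ u v : Fin n, s'.arr 0 ((u : ℕ) * n + v) =
          if u = v ∧ (u : ℕ) < k then 1 else s.arr 0 ((u : ℕ) * n + v)) ∧
        ∀ l, n * n ≤ l → s'.arr 0 l = s.arr 0 l)
    ⟨by simp, fun x hx => by simp [hx], fun _ _ => rfl, by simp, fun _ _ => rfl⟩ ?_ ?_ ?_ ?_
  · rintro k _ s' ⟨h1, h2, -⟩
    exact ⟨h1, by simp only [Expr.eval, h2 0 (by omega), hs]⟩
  · rintro k hk s' ⟨h1, h2, h3, h4, h5⟩
    refine Spec.store (k := k * n + k) (q := 1) ?_ rfl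
      ⟨h1, by simp, fun x hx => by simp [hx, h2 x hx], fun a ha => ?_, fun u v => ?_,
        fun l hl => ?_⟩ (by simp [Expr.steps])
    · simp [Expr.eval, h1, h2 0 (by omega), hs, Op.apply]
    · rw [State.setReg_arr, State.setCell_arr_of_ne _ _ _ ha, h3 a ha]
    · rw [State.setReg_arr, State.setCell_arr, h4]
      have := mul_add_inj (u := u) (v := v) (u' := ⟨k, hk⟩) (v' := ⟨k, hk⟩)
      simp only at this
      simp only [this, true_and, Fin.ext_iff]
      by_cases huv : (u : ℕ) = v
      · by_cases huk : (u : ℕ) = k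
        · simp [← huv, huk]
        · have hvk : (v : ℕ) ≠ k := huv ▸ huk
          have : (v : ℕ) < k + 1 ↔ (v : ℕ) < k := by omega
          simp only [huv, hvk, false_and, if_false, true_and, this]
      · have : ¬ ((u : ℕ) = k ∧ (v : ℕ) = k) := fun h => huv (h.1.trans h.2.symm)
        simp [huv, this]
    · have := mul_add_lt_mul (⟨k, hk⟩ : Fin n) ⟨k, hk⟩
      simp only at this
      rw [State.setReg_arr, State.setCell_arr, if_neg (by omega), h5 l hl]
  · rintro s' ⟨-, h2, h3, h4, h5⟩
    exact ⟨h2, h3, fun u v => by simp [h4], h5⟩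
  · simp [Expr.steps]; omega

lemma spec_copy {m : ℕ} (hm : 3 ≤ m) {s : State} (hs : s.reg 0 = n) :
    Spec (forLoop (m + 1) (.op .mul (.reg 0) (.reg 0))
      (.seq (.store 1 (.reg (m + 1)) (.cell 0 (.reg (m + 1))))
        (.store m (.reg (m + 1)) (.cell 0 (.reg (m + 1)))))) s
      (20 * (n * n) + 12) fun s' => (∀ x, x ≠ m + 1 → s'.reg x = s.reg x) ∧
        (∀ a, a ≠ 1 → a ≠ m → s'.arr a = s.arr a) ∧
        ∀ a, a = 1 ∨ a = m → ∀ k, s'.arr a k = if k < n * n then s.arr 0 k else s.arr a k := by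
  refine Spec.forLoop (N := n * n) (fun _ => 8)
    (fun k s' => s'.reg (m + 1) = k ∧ (∀ x, x ≠ m + 1 → s'.reg x = s.reg x) ∧
        (∀ a, a ≠ 1 → a ≠ m → s'.arr a = s.arr a) ∧
        ∀ a, a = 1 ∨ a = m → ∀ l, s'.arr a l = if l < k then s.arr 0 l else s.arr a l)
    ⟨by simp, fun x hx => by simp [hx], fun _ _ _ => rfl, by simp⟩ ?_ ?_ ?_ ?_
  · rintro k _ s' ⟨h1, h2, -⟩
    exact ⟨h1, by simp [Expr.eval, h2 0 (by omega), hs, Op.apply]⟩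
  · rintro k hk s' ⟨h1, h2, h3, h4⟩
    refine Spec.seq (b₁ := 4) (b₂ := 4) (Spec.store (k := k) (q := s.arr 0 k) ?_ ?_
      (Spec.store (k := k) (q := s.arr 0 k) ?_ ?_
        ⟨h1, by simp, fun x hx => by simp [hx, h2 x hx], fun a ha ha' => ?_, fun a ha l => ?_⟩
        (by simp [Expr.steps])) (by simp [Expr.steps])) le_rfl
    · simp [Expr.eval, h1]
    · simp [Expr.eval, h1, h3 0 (by omega) (by omega)]
    · simp [Expr.eval, h1]
    · simp [Expr.eval, h1, h3 0 (by omega) (by omega)]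
    · rw [State.setReg_arr, State.setCell_arr_of_ne _ _ _ ha', State.setCell_arr_of_ne _ _ _ ha,
        h3 a ha ha']
    · rw [State.setReg_arr, State.setCell_arr, State.setCell_arr, h4 a ha]
      by_cases hl : l = k
      · subst hl
        rcases ha with rfl | rfl <;> simp
      · have : l < k + 1 ↔ l < k := by omega
        simp [hl, this]
  · rintro s' ⟨-, h2, h3, h4⟩
    exact ⟨h2, h3, h4⟩
  · simp [Expr.steps]; omega

/-- Below m the state looks like the input of a multiplication. The copy in the array m lies out of
reach of a multiplication program bounded by m, and the zeros beyond it later say that no vertex is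
clustered yet. -/
lemma spec_prepProg {m : ℕ} (hm : 3 ≤ m) (G : SimpleGraph (Fin n)) :
    Spec (prepProg m) (clusteringInput G) (20 * (n * n) + 17 * n + 24) fun s =>
      Agree m (input (Matrix.of (posIndicator G)) (Matrix.of (posIndicator G))) s ∧
      s.reg m = n ∧ s.arr m = matrixArray (Matrix.of (posIndicator G)) ∧
      ∀ a, m < a → s.arr a = fun _ => 0 := by
  refine Spec.seq (b₁ := 2) (b₂ := 20 * (n * n) + 17 * n + 22) (Spec.assign (q := n) ?_ ?_
    (by simp [Expr.steps])) (by omega)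
  · simp [Expr.eval, clusteringInput, input]
  refine Spec.seq (b₁ := 17 * n + 10) (b₂ := 20 * (n * n) + 12)
    ((spec_diagonal (n := n) hm ?_).mono le_rfl ?_) (by omega)
  · rw [State.setReg_reg, if_neg (by omega)]
    simp [clusteringInput, input]
  rintro s₁ ⟨h1, h2, h3, h4⟩
  have hreg : ∀ x, x ≠ m → x ≠ m + 1 → s₁.reg x = if x = 0 then (n : ℚ) else 0 := fun x hx hx' => by
    rw [h1 x hx', State.setReg_reg, if_neg hx]; rfl
  refine (spec_copy (n := n) hm ?_).mono le_rfl ?_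
  · rw [hreg 0 (by omega) (by omega), if_pos rfl]
  rintro s₂ ⟨h5, h6, h7⟩
  have harr0 : s₁.arr 0 = matrixArray (Matrix.of (posIndicator G)) := by
    refine eq_matrixArray (fun u v => ?_) fun k hk => ?_
    · rw [h3]
      simp only [State.setReg_arr, clusteringInput, input, if_true, matrixArray_mul_add,
        Matrix.of_apply, posIndicator_eq, SimpleGraph.adjMatrix_apply]
      split_ifs <;> rfl
    · rw [h4 k hk]
      simp only [State.setReg_arr, clusteringInput, input, if_true]
      exact matrixArray_of_le _ hk
  have harr : ∀ a, a ≠ 0 → s₁.arr a = fun _ => 0 := fun a ha => by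
    rw [h2 a ha, State.setReg_arr]
    simp only [clusteringInput, input, if_neg ha]
    split_ifs
    · exact (eq_matrixArray (fun _ _ => rfl) fun _ _ => rfl).symm
    · rfl
  have hcopy : ∀ a, a = 1 ∨ a = m → s₂.arr a = matrixArray (Matrix.of (posIndicator G)) := by
    intro a ha
    funext k
    rw [h7 a ha, harr0, harr a (by omega)]
    split_ifs with hk
    · rfl
    · exact (matrixArray_of_le _ (by omega)).symm
  refine ⟨⟨fun x hx => ?_, fun a ha => ?_⟩, ?_, hcopy m (Or.inr rfl), fun a ha => ?_⟩
  · rw [h5 x (by omega), hreg x (by omega) (by omega)]; rfl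
  · by_cases ha0 : a = 0
    · rw [h6 a (by omega) (by omega), ha0, harr0]; rfl
    · by_cases ha1 : a = 1
      · rw [hcopy a (Or.inl ha1)]; simp [input, ha1]
      · rw [h6 a ha1 (by omega), harr a ha0]; simp [input, ha0, ha1]
  · rw [h5 m (by omega), h1 m (by omega)]; simp
  · rw [h6 a (by omega) (by omega), harr a (by omega)]

/-- The program that computes the adjusted correlation metric and rounds it, when the numbers of
common neighbors are known. -/
def metricProg (m : ℕ) : Prog :=
  .seq (rowLoop (m + 1) (m + 2) (m + 3) m (m + 1) (closeExpr m (m + 1) (m + 2))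
      (isoExpr m (m + 1) (m + 3)))
    (.seq (rowLoop (m + 1) (m + 2) (m + 3) m (m + 2) (proximityExpr m (m + 1) (m + 2))
      (.reg (m + 3)))
    (.seq (.assign (m + 6) (.reg m)) (roundingProg m)))

lemma spec_metricProg {m : ℕ} (hm : 3 ≤ m) {G : SimpleGraph (Fin n)} {s : State}
    (h : HasGraph m G s) (h0 : s.arr (m + 3) = fun _ => 0) :
    Spec (metricProg m) s (1500 * ((n + 1) * (n + 1))) fun s' =>
      IsRoundingOutput (adjCorrMetric G) (clusteringOutput n s') := by
  have hs1 := steps_closeExpr m (m + 1) (m + 2)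
  have hs2 := steps_isoExpr m (m + 1) (m + 3)
  have hs3 := steps_proximityExpr m (m + 1) (m + 2)
  have hcost : (n + 1) * (n + 1) * 110 +
      ((n + 1) * (n + 1) * 531 + (2 + (820 * (n + 1) * n + 4))) ≤ 1500 * ((n + 1) * (n + 1)) := by
    ring_nf
    omega
  refine Spec.seq (b₁ := (n + 1) * (n + 1) * 110)
    (b₂ := (n + 1) * (n + 1) * 531 + (2 + (820 * (n + 1) * n + 4)))
    (Spec.rowLoop (n := n) (fun u v => (1 - posIndicator G u v) *
      (1 - if 7 / 10 < corrMetric G u v then 1 else 0)) (isoIndicator G) (by omega) (by omega)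
      (by omega) (by omega) (by omega) (by omega) h.dim ?_ ?_ ?_
      (Nat.mul_le_mul_left _ (by omega))) hcost
  · intro s' hr ha u v hu hv
    exact (h.congr (hr _ (by omega) (by omega) (by omega)) (ha _ (by omega))
      (ha _ (by omega))).eval_closeExpr hu hv
  · intro s' hr ha u hu hc
    exact (h.congr (hr _ (by omega) (by omega) (by omega)) (ha _ (by omega))
      (ha _ (by omega))).eval_isoExpr hu hc
  intro s₁ hr₁ ha₁ hi₁
  have h₁ : HasMetric m G s₁ := ⟨h.congr (hr₁ _ (by omega) (by omega) (by omega))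
    (ha₁ _ (by omega)) (ha₁ _ (by omega)), hi₁⟩
  refine Spec.seq (b₁ := (n + 1) * (n + 1) * 531) (b₂ := 2 + (820 * (n + 1) * n + 4))
    (Spec.rowLoop (n := n) (proximity G) (fun u => ∑ v, proximity G u v) (by omega) (by omega)
      (by omega) (by omega) (by omega) (by omega) h₁.dim ?_ ?_ ?_
      (Nat.mul_le_mul_left _ (by simp only [Expr.steps]; omega))) le_rfl
  · intro s' hr ha u v hu hv
    exact (h₁.congr (hr _ (by omega) (by omega) (by omega)) (ha _ (by omega))
      (ha _ (by omega)) (ha _ (by omega))).eval_proximityExpr hu hv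
  · intro s' hr ha u hu hc
    simp only [Expr.eval, hc]
  intro s₂ hr₂ ha₂ hi₂
  have h₂ : HasMetric m G s₂ := h₁.congr (hr₂ _ (by omega) (by omega) (by omega))
    (ha₂ _ (by omega)) (ha₂ _ (by omega)) (ha₂ _ (by omega))
  refine Spec.seq (b₁ := 2) (b₂ := 820 * (n + 1) * n + 4) (Spec.assign (q := n) ?_ ?_
    (by simp [Expr.steps])) le_rfl
  · simp only [Expr.eval, h₂.dim]
  have h₃ : HasUnclustered m G Finset.univ (s₂.setReg (m + 6) n) := by
    refine ⟨h₂.congr (by simp) rfl rfl rfl, by simp, fun u => ?_, fun u => ?_⟩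
    · rw [State.setReg_arr, ha₂ _ (by omega), ha₁ _ (by omega), h0]; simp
    · rw [State.setReg_arr, hi₂]
  refine (spec_roundingProg hm Finset.univ _ h₃).mono (by simp) ?_
  rintro s' ⟨Cs, hrun, -, -, hiff⟩
  exact ⟨Cs, hrun, fun u v => hiff u (Finset.mem_univ u) v (Finset.mem_univ v)⟩

end Main

end RatRAM

open CorrelationClustering RatRAM in
theorem theorem1 (T : ℕ → ℝ) (hT : MatrixMultiplicationTime T) :
    ∃ (P : Prog) (K : ℝ), ∀ n : ℕ, 0 < n → ∀ G : SimpleGraph (Fin n),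
      ∃ (t : ℕ) (s : State), Runs P (clusteringInput G) t s ∧ (t : ℝ) ≤ K * T n ∧
        IsRoundingOutput (adjCorrMetric G) (clusteringOutput n s) ∧
        ∀ p : ENNReal, 1 ≤ p → cost G p (clusteringOutput n s) ≤ 6348 * opt G p := by
  obtain ⟨M, K, hM⟩ := hT
  -- Private registers and arrays start at m, beyond everything `M` mentions and beyond the arrays
  -- 0, 1, 2 of its interface.
  set m := max 3 M.bound with hm_def
  have hm : 3 ≤ m := le_max_left _ _
  have hmM : M.bound ≤ m := le_max_right _ _
  refine ⟨.seq (prepProg m) (.seq M (metricProg m)), 7000 * K, fun n hn G => ?_⟩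
  -- The multiplication bound, applied to all-ones matrices, shows that quadratic overhead is free.
  have hsq : ((n * n : ℕ) : ℝ) ≤ K * T n := by
    obtain ⟨t, s, hrun, ht, hs⟩ := hM n hn (Matrix.of fun _ _ => 1) (Matrix.of fun _ _ => 1)
    exact le_trans (by exact_mod_cast sq_le_of_runs hn hrun hs) ht
  obtain ⟨t₁, s₁, run₁, ht₁, hagree, hdim, harr, hzero⟩ := spec_prepProg hm G
  obtain ⟨t₂, r, run, ht₂, hprod⟩ := hM n hn (Matrix.of (posIndicator G))
    (Matrix.of (posIndicator G))
  obtain ⟨s₂, run₂, hagree₂, hreg₂, harr₂⟩ := run.transfer hmM s₁ hagree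
  have hG : HasGraph m G s₂ := by
    refine ⟨(hreg₂ m le_rfl).trans hdim, fun u v => ?_, fun u v => ?_⟩
    · rw [hagree₂.2 2 (by omega), hprod, Matrix.mul_apply, commonCount_eq_sum]
      rfl
    · rw [harr₂ m le_rfl, harr, matrixArray_mul_add]
      rfl
  obtain ⟨t₃, s₃, run₃, ht₃, hout⟩ := spec_metricProg hm hG
    ((harr₂ _ (by omega)).trans (hzero _ (by omega)))
  refine ⟨_, s₃, .seq _ _ _ _ _ _ _ run₁ (.seq _ _ _ _ _ _ _ run₂ run₃), ?_, hout,
    fun p hp => cost_le_of_isRoundingOutput hout hp⟩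
  -- Since n ≥ 1, the lower-order terms are absorbed by n². One further K T(n) pays for the
  -- multiplication itself, which makes 7000.
  have h1 : t₁ + t₃ ≤ 6999 * (n * n) := by nlinarith
  have h2 : ((t₁ + t₃ : ℕ) : ℝ) ≤ 6999 * ((n * n : ℕ) : ℝ) := by exact_mod_cast h1
  push_cast at h2 hsq ⊢
  linarith
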